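/- For a probability measure $\eta$ on $\mathbb R$ let $F_\eta(x)=\eta((-\infty,x])$ and $F_\eta^{-1}(u)=\inf\{x\in\mathbb R: F_\eta(x)\ge u\}$ for $u\in(0,1)$, and let $\lambda_{(0,1)}$ be the Lebesgue measure on $(0,1)$. For $\rho\ge 1$, $\mathcal P_\rho(\mathbb R)$ is the set of probability measures on $\mathbb R$ with finite moment of order $\rho$, $\Pi(\alpha,\beta)$ is the set of couplings of $\alpha$ and $\beta$, and $\mathcal W_\rho(\mu,\nu)=\inf_{\pi\in\Pi(\mu,\nu)}\left(\int|x-y|^\rho\,\pi(dx,dy)\right)^{1/\rho}$. For $\pi(dx,dy)=\alpha(dx)\,\pi_x(dy)$ and $\pi'(dx,dy)=\alpha'(dx)\,\pi'_x(dy)$ on $\mathbb R\times\mathbb R$, $$\mathcal{AW}_\rho(\pi,\pi')=\inf_{\chi\in\Pi(\alpha,\alpha')}\left(\int\left(|x-x'|^\rho+\mathcal W_\rho^\rho(\pi_x,\pi'_{x'})\right)\chi(dx,dx')\right)^{1/\rho},$$ and for $\widehat\pi(du,dx,dy)=\lambda_{(0,1)}(du)\,\widehat\pi_u(dx,dy)$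 and $\widehat\pi'(du,dx,dy)=\lambda_{(0,1)}(du)\,\widehat\pi'_u(dx,dy)$ on $(0,1)\times\mathbb R\times\mathbb R$, $$\widehat{\mathcal{AW}}_\rho(\widehat\pi,\widehat\pi')=\inf_{\chi\in\Pi(\lambda_{(0,1)},\lambda_{(0,1)})}\left(\int\left(|u-u'|^\rho+\mathcal{AW}_\rho^\rho(\widehat\pi_u,\widehat\pi'_{u'})\right)\chi(du,du')\right)^{1/\rho}.$$ Let $\mu,\nu\in\mathcal P_1(\mathbb R)$ with $\mu\le_{cx}\nu$ (convex order: $\int f\,d\mu\le\int f\,d\nu$ for all convex $f:\mathbb R\to\mathbb R$ integrable with respect to both). For $u\in[0,1]$ put $\Psi_\pm(u)=\int_0^u(F_\mu^{-1}-F_\nu^{-1})^\pm(v)\,dv$, with left-continuous generalised inverses $\Psi_\pm^{-1}(r)=\inf\{v\in[0,1]:\Psi_\pm(v)\ge r\}$. For $u\in(0,1)$ let $\varphi(u)$ be $\Psi_-^{-1}(\Psi_+(u))$ if $F_\mu^{-1}(u)>F_\nu^{-1}(u)$, $\Psi_+^{-1}(\Psi_-(u))$ if $F_\mu^{-1}(u)<F_\nu^{-1}(u)$,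 and $u$ if $F_\mu^{-1}(u)=F_\nu^{-1}(u)$. Let $p(u)=\frac{F_\mu^{-1}(u)-F_\nu^{-1}(u)}{F_\nu^{-1}(\varphi(u))-F_\nu^{-1}(u)}$ if $F_\mu^{-1}(u)\ne F_\nu^{-1}(u)$ and $p(u)=0$ otherwise; for almost every $u$ this is well defined and lies in $[0,1]$. The lifted inverse transform martingale coupling between $\mu$ and $\nu$ is $$\widehat M^{IT}(du,dx,dy)=\lambda_{(0,1)}(du)\,\delta_{F_\mu^{-1}(u)}(dx)\,\widetilde m^{IT}_u(dy),\qquad \widetilde m^{IT}_u=p(u)\,\delta_{F_\nu^{-1}(\varphi(u))}+(1-p(u))\,\delta_{F_\nu^{-1}(u)}\quad\text{for a.e. }u\in(0,1).$$ **Proposition.** Let $\rho\ge1$, let $\mu_n,\nu_n\in\mathcal P_\rho(\mathbb R)$, $n\in\mathbb N$, satisfy $\mu_n\le_{cx}\nu_n$, and suppose that $\mu_n\to\mu\in\mathcal P_\rho(\mathbb R)$ and $\nu_n\to\nu\in\mathcal P_\rho(\mathbb R)$ in $\mathcal W_\rho$ as $n\to\infty$. Denote by $\widehat M^{IT}_n$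 and $(\widetilde m^{IT}_n)_u$, respectively $\widehat M^{IT}$ and $\widetilde m^{IT}_u$, the objects above for $(\mu_n,\nu_n)$, respectively $(\mu,\nu)$. Then, for all $n$, $$\widehat{\mathcal{AW}}_\rho^\rho(\widehat M^{IT}_n,\widehat M^{IT})\le 2\int_{(0,1)}\mathcal W_\rho^\rho\left((\widetilde m^{IT}_n)_u,\widetilde m^{IT}_u\right)du,$$ and $$\int_{(0,1)}\mathcal W_\rho^\rho\left((\widetilde m^{IT}_n)_u,\widetilde m^{IT}_u\right)du\underset{n\to\infty}{\longrightarrow}0,\qquad \widehat{\mathcal{AW}}_\rho(\widehat M^{IT}_n,\widehat M^{IT})\underset{n\to\infty}{\longrightarrow}0.$$ -/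

import Mathlib

open MeasureTheory ProbabilityTheory Filter Set
open scoped ENNReal Topology

noncomputable section

namespace LiftedIT

/-! ### Measures on the line: moments, convex order, quantile functions -/

/-- `μ ∈ 𝒫_ρ(ℝ)`: a probability measure on the line with finite moment of order `ρ`. -/
structure HasFiniteMoment (ρ : ℝ) (μ : Measure ℝ) : Prop where
  isProbabilityMeasure : IsProbabilityMeasure μ
  integrable : Integrable (fun x : ℝ => |x| ^ ρ) μ

/-- The convex order `μ ≤_cx ν`: `∫ f dμ ≤ ∫ f dν` for every convex `f : ℝ → ℝ` for which both
integrals are finite. -/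
def ConvexOrder (μ ν : Measure ℝ) : Prop :=
  ∀ f : ℝ → ℝ, ConvexOn ℝ univ f → Integrable f μ → Integrable f ν → ∫ x, f x ∂μ ≤ ∫ x, f x ∂ν

/-- The quantile function `F_η⁻¹(u) = inf {x | F_η(x) ≥ u}`, meaningful for `u ∈ (0, 1)`. -/
def quantile (η : Measure ℝ) (u : ℝ) : ℝ := sInf {x : ℝ | u ≤ cdf η x}

/-- The Lebesgue measure on `(0, 1)`, seen as a measure on the line. -/
def unitLebesgue : Measure ℝ := volume.restrict (Ioo (0 : ℝ) 1)

instance : IsProbabilityMeasure unitLebesgue := ⟨by simp [unitLebesgue]⟩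

/-! ### Couplings and Wasserstein distances (with values in `[0, ∞]`) -/

/-- `Π(μ, ν)`: the measures with marginals `μ` and `ν`. -/
def couplings {X Y : Type*} [MeasurableSpace X] [MeasurableSpace Y]
    (μ : Measure X) (ν : Measure Y) : Set (Measure (X × Y)) :=
  {π | π.fst = μ ∧ π.snd = ν}

/-- The Wasserstein distance `𝒲_ρ` on the line. -/
def wasserstein (ρ : ℝ) (μ ν : Measure ℝ) : ℝ≥0∞ :=
  ⨅ π ∈ couplings μ ν, (∫⁻ z, edist z.1 z.2 ^ ρ ∂π) ^ (1 / ρ)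

/-- The adapted Wasserstein distance `𝒜𝒲_ρ` between measures on `ℝ × ℝ`, where
`π(dx, dy) = π.fst(dx) π_x(dy)` is disintegrated by `π_x = π.condKernel x`. -/
def adaptedWasserstein (ρ : ℝ) (π π' : Measure (ℝ × ℝ)) [IsFiniteMeasure π] [IsFiniteMeasure π'] :
    ℝ≥0∞ :=
  ⨅ χ ∈ couplings π.fst π'.fst,
    (∫⁻ z, (edist z.1 z.2 ^ ρ + wasserstein ρ (π.condKernel z.1) (π'.condKernel z.2) ^ ρ) ∂χ)
      ^ (1 / ρ)

/-- The lifted adapted Wasserstein distance of order `ρ` between measures `λ_{(0,1)}(du) π_u(dx, dy)`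
and `λ_{(0,1)}(du) π'_u(dx, dy)` on `ℝ × (ℝ × ℝ)`. -/
def liftedAdaptedWasserstein (ρ : ℝ) (π π' : Measure (ℝ × (ℝ × ℝ)))
    [IsFiniteMeasure π] [IsFiniteMeasure π'] : ℝ≥0∞ :=
  ⨅ χ ∈ couplings unitLebesgue unitLebesgue,
    (∫⁻ z, (edist z.1 z.2 ^ ρ
        + adaptedWasserstein ρ (π.condKernel z.1) (π'.condKernel z.2) ^ ρ) ∂χ) ^ (1 / ρ)

/-! ### The lifted inverse transform martingale coupling -/

/-- `Ψ₊(u) = ∫₀ᵘ (F_μ⁻¹ - F_ν⁻¹)⁺(v) dv`. -/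
def psiPlus (μ ν : Measure ℝ) (u : ℝ) : ℝ := ∫ v in (0 : ℝ)..u, max (quantile μ v - quantile ν v) 0

/-- `Ψ₋(u) = ∫₀ᵘ (F_μ⁻¹ - F_ν⁻¹)⁻(v) dv`. -/
def psiMinus (μ ν : Measure ℝ) (u : ℝ) : ℝ := psiPlus ν μ u

/-- The left-continuous generalised inverse `r ↦ inf {v ∈ [0, 1] | Ψ(v) ≥ r}` of a nondecreasing
function `Ψ` on `[0, 1]`. -/
def leftInverse (Ψ : ℝ → ℝ) (r : ℝ) : ℝ := sInf {v : ℝ | v ∈ Icc (0 : ℝ) 1 ∧ r ≤ Ψ v}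

open Classical in
/-- The map `φ`: `Ψ₋⁻¹ ∘ Ψ₊` where `F_μ⁻¹ > F_ν⁻¹`, `Ψ₊⁻¹ ∘ Ψ₋` where `F_μ⁻¹ < F_ν⁻¹`, and the
identity where `F_μ⁻¹ = F_ν⁻¹`. -/
def phi (μ ν : Measure ℝ) (u : ℝ) : ℝ :=
  if quantile ν u < quantile μ u then leftInverse (psiMinus μ ν) (psiPlus μ ν u)
  else if quantile μ u < quantile ν u then leftInverse (psiPlus μ ν) (psiMinus μ ν u)
  else u

open Classical in
/-- The weight `p(u) = 1_{F_μ⁻¹(u) ≠ F_ν⁻¹(u)} (F_μ⁻¹(u) - F_ν⁻¹(u)) / (F_ν⁻¹(φ(u)) - F_ν⁻¹(u))`. -/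
def weight (μ ν : Measure ℝ) (u : ℝ) : ℝ :=
  if quantile μ u ≠ quantile ν u then
    (quantile μ u - quantile ν u) / (quantile ν (phi μ ν u) - quantile ν u)
  else 0

open Classical in
/-- The measure `m_u = p(u) δ_{F_ν⁻¹(φ(u))} + (1 - p(u)) δ_{F_ν⁻¹(u)}`. When `μ ≤_cx ν`, one has
`p(u) ∈ [0, 1]` for almost every `u ∈ (0, 1)`; at the other points, `m_u` is `δ_{F_ν⁻¹(u)}`, so that
`m` is always a probability kernel. -/
def itMeasure (μ ν : Measure ℝ) (u : ℝ) : Measure ℝ :=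
  if weight μ ν u ∈ Icc (0 : ℝ) 1 then
    ENNReal.ofReal (weight μ ν u) • Measure.dirac (quantile ν (phi μ ν u))
      + ENNReal.ofReal (1 - weight μ ν u) • Measure.dirac (quantile ν u)
  else Measure.dirac (quantile ν u)

/-! Measurability in `u` of the objects above. -/

theorem measurable_sInf_of_antitone {S : ℝ → Set ℝ} (hS : Antitone S) :
    Measurable fun u => sInf (S u) := by
  classical
  set L : Set ℝ := {u | (S u).Nonempty ∧ BddBelow (S u)} with hL
  have hLo : OrdConnected L := ⟨fun a ha b hb c hc =>
    ⟨hb.1.mono (hS hc.2), ha.2.mono (hS hc.1)⟩⟩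
  have hLm : MeasurableSet L := hLo.measurableSet
  have hmono : Monotone (fun u : L => sInf (S u)) := fun a b hab =>
    csInf_le_csInf a.2.2 b.2.1 (hS hab)
  have h1 : Measurable (fun u : L => sInf (S u)) := hmono.measurable
  have h2 : Measurable (fun u : (Lᶜ : Set ℝ) => sInf (S u)) := by
    have : (fun u : (Lᶜ : Set ℝ) => sInf (S u)) = fun _ => 0 := by
      funext u
      by_cases hne : (S u).Nonempty
      · exact Real.sInf_of_not_bddBelow fun hb => u.2 ⟨hne, hb⟩
      · rw [Set.not_nonempty_iff_eq_empty.1 hne, Real.sInf_empty]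
    rw [this]
    exact measurable_const
  exact measurable_of_restrict_of_restrict_compl hLm h1 h2

theorem measurable_quantile (η : Measure ℝ) : Measurable (quantile η) :=
  measurable_sInf_of_antitone fun _ _ hab _ hx => le_trans hab hx

theorem measurable_leftInverse (Ψ : ℝ → ℝ) : Measurable (leftInverse Ψ) :=
  measurable_sInf_of_antitone fun _ _ hab _ hx => ⟨hx.1, le_trans hab hx.2⟩

theorem measurable_psiPlus (μ ν : Measure ℝ) : Measurable (psiPlus μ ν) := by
  set f : ℝ → ℝ := fun v => max (quantile μ v - quantile ν v) 0 with hf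
  have hfm : Measurable f :=
    ((measurable_quantile μ).sub (measurable_quantile ν)).max measurable_const
  have h1 : Measurable fun u : ℝ => ∫ v in Ioc (0 : ℝ) u, f v := by
    have hs : MeasurableSet {z : ℝ × ℝ | 0 < z.2 ∧ z.2 ≤ z.1} :=
      (measurableSet_lt measurable_const measurable_snd).inter
        (measurableSet_le measurable_snd measurable_fst)
    have hm := (((hfm.comp measurable_snd).indicator hs).stronglyMeasurable.integral_prod_right'
      (ν := (volume : Measure ℝ))).measurable
    convert hm using 1
    funext u
    rw [← integral_indicator measurableSet_Ioc]
    rfl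
  have h2 : Measurable fun u : ℝ => ∫ v in Ioc u (0 : ℝ), f v := by
    have hs : MeasurableSet {z : ℝ × ℝ | z.1 < z.2 ∧ z.2 ≤ 0} :=
      (measurableSet_lt measurable_fst measurable_snd).inter
        (measurableSet_le measurable_snd measurable_const)
    have hm := (((hfm.comp measurable_snd).indicator hs).stronglyMeasurable.integral_prod_right'
      (ν := (volume : Measure ℝ))).measurable
    convert hm using 1
    funext u
    rw [← integral_indicator measurableSet_Ioc]
    rfl
  exact h1.sub h2

theorem measurable_psiMinus (μ ν : Measure ℝ) : Measurable (psiMinus μ ν) :=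
  measurable_psiPlus ν μ

theorem measurable_phi (μ ν : Measure ℝ) : Measurable (phi μ ν) :=
  Measurable.ite (measurableSet_lt (measurable_quantile ν) (measurable_quantile μ))
    ((measurable_leftInverse _).comp (measurable_psiPlus μ ν))
    (Measurable.ite (measurableSet_lt (measurable_quantile μ) (measurable_quantile ν))
      ((measurable_leftInverse _).comp (measurable_psiMinus μ ν)) measurable_id)

theorem measurable_weight (μ ν : Measure ℝ) : Measurable (weight μ ν) :=
  Measurable.ite (measurableSet_eq_fun (measurable_quantile μ) (measurable_quantile ν)).compl
    (((measurable_quantile μ).sub (measurable_quantile ν)).div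
      (((measurable_quantile ν).comp (measurable_phi μ ν)).sub (measurable_quantile ν)))
    measurable_const

theorem measurable_itMeasure (μ ν : Measure ℝ) : Measurable (itMeasure μ ν) := by
  have hq := measurable_quantile ν
  have hw := measurable_weight μ ν
  refine Measurable.ite (hw measurableSet_Icc) ?_ (Measure.measurable_dirac.comp hq)
  refine Measure.measurable_of_measurable_coe _ fun s hs => ?_
  have hd : ∀ g : ℝ → ℝ, Measurable g → Measurable fun u => Measure.dirac (g u) s := fun g hg =>
    (Measure.measurable_coe hs).comp (Measure.measurable_dirac.comp hg)
  simp only [Measure.coe_add, Measure.coe_smul, Pi.add_apply, Pi.smul_apply, smul_eq_mul]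
  exact (hw.ennreal_ofReal.mul (hd _ (hq.comp (measurable_phi μ ν)))).add
    ((measurable_const.sub hw).ennreal_ofReal.mul (hd _ hq))

/-- The probability kernel `(m_u)` of the inverse transform martingale coupling. -/
def itKernel (μ ν : Measure ℝ) : Kernel ℝ ℝ := ⟨itMeasure μ ν, measurable_itMeasure μ ν⟩

instance (μ ν : Measure ℝ) : IsMarkovKernel (itKernel μ ν) := ⟨fun u => ⟨by
  change itMeasure μ ν u univ = 1
  unfold itMeasure
  split_ifs with h
  · simp only [Measure.coe_add, Measure.coe_smul, Pi.add_apply, Pi.smul_apply, smul_eq_mul,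
      measure_univ, mul_one]
    rw [← ENNReal.ofReal_add h.1 (sub_nonneg.2 h.2)]
    simp
  · exact measure_univ⟩⟩

/-- The measure `λ_{(0,1)}(du) δ_{F_μ⁻¹(u)}(dx) p_u(dy)` on `ℝ × (ℝ × ℝ)`. -/
def liftedCoupling (μ : Measure ℝ) (p : Kernel ℝ ℝ) : Measure (ℝ × (ℝ × ℝ)) :=
  unitLebesgue.compProd ((Kernel.deterministic (quantile μ) (measurable_quantile μ)).prod p)

instance (μ : Measure ℝ) (p : Kernel ℝ ℝ) [IsMarkovKernel p] :
    IsProbabilityMeasure (liftedCoupling μ p) := by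
  unfold liftedCoupling; infer_instance

/-- The lifted inverse transform martingale coupling `λ_{(0,1)}(du) δ_{F_μ⁻¹(u)}(dx) m_u(dy)` between
`μ` and `ν`. -/
abbrev liftedIT (μ ν : Measure ℝ) : Measure (ℝ × (ℝ × ℝ)) := liftedCoupling μ (itKernel μ ν)

end LiftedIT

end

noncomputable section

namespace LiftedIT

/-! ### Quantile functions -/

/-! Realise every kernel on one probability space, the unit square: `itMap` sends `(u, w)` to
`F_ν⁻¹(φ(u))` if `w < p(u)` and to `F_ν⁻¹(u)` otherwise, so for almost every `u` its law in `w` is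
`m_u`. The integral of `𝒲_ρ^ρ` over `u` is then at most `∫∫ |Y_n - Y|^ρ`, where `Y_n` and `Y` denote
these maps, and it suffices to show `Y_n → Y` in `L^ρ`. This follows from two facts.

Moments: the law of `Y_n` on the square is `ν_n`, because the mass `p(u)` sent from `u` to `φ(u)` is
balanced by the mass sent onto `u` (`QuantileDominated.lintegral_weight_mul_comp_phi`, by the
substitution `r = Ψ±(u)`). Hence the moments of order `ρ` converge, and with almost everywhere
convergence a Fatou argument gives `L^ρ` convergence (`tendsto_lintegral_edist_rpow_of_ae_tendsto`).

Almost everywhere convergence (`ae_tendsto_itMap`): quantile functions converge at continuity points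
of the limit, and `Ψ±` converge pointwise because the quantile functions converge in `L¹`. Where
`F_μ⁻¹ ≠ F_ν⁻¹`, almost every level `u` is matched to a `c = φ(u)` at which the opposite `Ψ`
strictly crosses the level and `F_ν⁻¹` is continuous (`ae_isMatched`), so `φ_n(u) → φ(u)` and the
atoms and weights converge. Where `F_μ⁻¹ = F_ν⁻¹`, `φ_n(u)` is uncontrolled, but the martingale
identity makes `p_n(u)` times the jump tend to zero.

The bound on the lifted distance comes from the diagonal coupling in `u`. Since `m_u` has mean
`F_μ⁻¹(u)`, the distance between first coordinates is at most the Wasserstein distance between the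
kernels, whence the factor 2. -/

theorem isClosed_setOf_le_cdf (η : Measure ℝ) (u : ℝ) : IsClosed {x : ℝ | u ≤ cdf η x} := by
  rw [← isOpen_compl_iff, isOpen_iff_mem_nhds]
  intro x hx
  have hx : cdf η x < u := not_le.1 hx
  have h1 : ∀ᶠ y in 𝓝[≥] x, cdf η y < u :=
    ((cdf η).right_continuous x).eventually_lt_const hx
  have h2 : ∀ᶠ y in 𝓝[≤] x, cdf η y < u :=
    eventually_nhdsWithin_of_forall fun y hy => (monotone_cdf η hy).trans_lt hx
  have h3 : ∀ᶠ y in 𝓝 x, cdf η y < u := by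
    rw [← nhdsLE_sup_nhdsGE, eventually_sup]; exact ⟨h2, h1⟩
  filter_upwards [h3] with y hy using not_le.2 hy

/-- Right continuity of the cdf makes the infimum attained; `0 < u < 1` makes the set bounded below
and nonempty. Monotonicity, the law and the stability of the quantile function all come from this
equivalence. -/
theorem quantile_le_iff (η : Measure ℝ) {u : ℝ} (hu : u ∈ Ioo (0 : ℝ) 1) (x : ℝ) :
    quantile η u ≤ x ↔ u ≤ cdf η x := by
  have hne : {x : ℝ | u ≤ cdf η x}.Nonempty :=
    ((tendsto_cdf_atTop η).eventually (Ici_mem_nhds hu.2)).exists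
  have hbdd : BddBelow {x : ℝ | u ≤ cdf η x} := by
    obtain ⟨b, hb⟩ := ((tendsto_cdf_atBot η).eventually_lt_const hu.1).exists
    exact ⟨b, fun y hy => le_of_not_gt fun h =>
      absurd (hy.trans (monotone_cdf η h.le)) (not_le.2 hb)⟩
  have hmem : u ≤ cdf η (quantile η u) := (isClosed_setOf_le_cdf η u).csInf_mem hne hbdd
  exact ⟨fun h => hmem.trans (monotone_cdf η h), fun h => csInf_le hbdd h⟩

theorem monotoneOn_quantile (η : Measure ℝ) : MonotoneOn (quantile η) (Ioo 0 1) :=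
  fun _ hu _ hv huv => (quantile_le_iff η hu _).2 (huv.trans ((quantile_le_iff η hv _).1 le_rfl))

theorem countable_not_continuousAt_quantile (η : Measure ℝ) :
    {u | u ∈ Ioo (0 : ℝ) 1 ∧ ¬ ContinuousAt (quantile η) u}.Countable := by
  refine (monotoneOn_quantile η).countable_not_continuousWithinAt.mono ?_
  exact fun u hu => ⟨hu.1, fun h => hu.2 (h.continuousAt (isOpen_Ioo.mem_nhds hu.1))⟩

theorem ae_mem_Ioo_unitLebesgue : ∀ᵐ u ∂unitLebesgue, u ∈ Ioo (0 : ℝ) 1 :=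
  ae_restrict_mem measurableSet_Ioo

theorem unitLebesgue_Iic {p : ℝ} (hp : p ∈ Icc (0 : ℝ) 1) :
    unitLebesgue (Iic p) = ENNReal.ofReal p := by
  have : unitLebesgue (Iic p) = (volume.restrict (Ioc (0 : ℝ) 1)) (Iic p) := by
    rw [unitLebesgue, Measure.restrict_congr_set Ioo_ae_eq_Ioc]
  rw [this, Measure.restrict_apply measurableSet_Iic, inter_comm, Ioc_inter_Iic, min_eq_right hp.2,
    Real.volume_Ioc, sub_zero]

theorem unitLebesgue_Iio {p : ℝ} (hp : p ∈ Icc (0 : ℝ) 1) :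
    unitLebesgue (Iio p) = ENNReal.ofReal p := by
  rw [unitLebesgue, Measure.restrict_congr_set Ioo_ae_eq_Ico,
    Measure.restrict_apply measurableSet_Iio, inter_comm, Ico_inter_Iio, min_eq_right hp.2,
    Real.volume_Ico, sub_zero]

theorem map_quantile (η : Measure ℝ) [IsProbabilityMeasure η] :
    unitLebesgue.map (quantile η) = η := by
  have := Measure.isProbabilityMeasure_map (μ := unitLebesgue) (measurable_quantile η).aemeasurable
  refine Measure.ext_of_Iic _ _ fun x => ?_
  rw [Measure.map_apply (measurable_quantile η) measurableSet_Iic, ← ofReal_cdf η x,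
    ← unitLebesgue_Iic ⟨cdf_nonneg η x, cdf_le_one η x⟩]
  refine measure_congr ?_
  filter_upwards [ae_mem_Ioo_unitLebesgue] with u hu
  exact propext (quantile_le_iff η hu x)

theorem ae_continuousAt_quantile (η : Measure ℝ) :
    ∀ᵐ u ∂unitLebesgue, ContinuousAt (quantile η) u := by
  have h := ae_restrict_of_ae (s := Ioo (0 : ℝ) 1)
    ((countable_not_continuousAt_quantile η).ae_notMem volume)
  filter_upwards [h, ae_mem_Ioo_unitLebesgue] with u hu hu'
  by_contra hc
  exact hu ⟨hu', hc⟩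

/-! ### Couplings and the Wasserstein distance -/

theorem map_mem_couplings {Ω X Y : Type*} [MeasurableSpace Ω] [MeasurableSpace X]
    [MeasurableSpace Y] (m : Measure Ω) {f : Ω → X} {g : Ω → Y} (hf : Measurable f)
    (hg : Measurable g) : m.map (fun ω => (f ω, g ω)) ∈ couplings (m.map f) (m.map g) :=
  ⟨Measure.fst_map_prodMk hg, Measure.snd_map_prodMk hf⟩

theorem wasserstein_rpow_le {ρ : ℝ} (hρ : 0 < ρ) {α β : Measure ℝ} {π : Measure (ℝ × ℝ)}
    (hπ : π ∈ couplings α β) :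
    wasserstein ρ α β ^ ρ ≤ ∫⁻ z, edist z.1 z.2 ^ ρ ∂π :=
  (ENNReal.le_rpow_inv_iff hρ).1 (one_div ρ ▸ iInf₂_le π hπ)

theorem wasserstein_map_rpow_le {ρ : ℝ} (hρ : 0 < ρ) {Ω : Type*} [MeasurableSpace Ω]
    (m : Measure Ω) {f g : Ω → ℝ} (hf : Measurable f) (hg : Measurable g) :
    wasserstein ρ (m.map f) (m.map g) ^ ρ ≤ ∫⁻ ω, edist (f ω) (g ω) ^ ρ ∂m :=
  (wasserstein_rpow_le hρ (map_mem_couplings m hf hg)).trans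
    (lintegral_map_le _ _)

theorem wasserstein_comm (ρ : ℝ) (α β : Measure ℝ) : wasserstein ρ α β = wasserstein ρ β α := by
  have key : ∀ α β : Measure ℝ, wasserstein ρ β α ≤ wasserstein ρ α β := by
    intro α β
    refine le_iInf₂ fun π hπ => ?_
    have h : π.map Prod.swap ∈ couplings β α :=
      ⟨by rw [Measure.fst_map_swap]; exact hπ.2, by rw [Measure.snd_map_swap]; exact hπ.1⟩
    refine (iInf₂_le _ h).trans (le_of_eq ?_)
    rw [lintegral_map (by fun_prop) measurable_swap]
    simp only [Prod.fst_swap, Prod.snd_swap, edist_comm]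
  exact le_antisymm (key _ _) (key _ _)

/-- Minkowski's inequality in `L^ρ(π)` for each coupling `π`, followed by the infimum over `π`. It
gives an upper bound on the moments of `ν_n`. -/
theorem rpow_lintegral_enorm_le_add_wasserstein {ρ : ℝ} (hρ : 1 ≤ ρ) (α β : Measure ℝ) :
    (∫⁻ x, ‖x‖ₑ ^ ρ ∂α) ^ (1 / ρ) ≤ (∫⁻ x, ‖x‖ₑ ^ ρ ∂β) ^ (1 / ρ) + wasserstein ρ α β := by
  have hρ0 : 0 < ρ := one_pos.trans_le hρ
  simp only [wasserstein, ENNReal.add_iInf]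
  refine le_iInf₂ fun π hπ => ?_
  have h1 : ∫⁻ x, ‖x‖ₑ ^ ρ ∂α = ∫⁻ z, ‖z.1‖ₑ ^ ρ ∂π := by
    rw [← hπ.1, Measure.fst, lintegral_map (by fun_prop) measurable_fst]
  have h2 : ∫⁻ x, ‖x‖ₑ ^ ρ ∂β = ∫⁻ z, ‖z.2‖ₑ ^ ρ ∂π := by
    rw [← hπ.2, Measure.snd, lintegral_map (by fun_prop) measurable_snd]
  rw [h1, h2]
  have h3 := ENNReal.lintegral_Lp_add_le (μ := π) (p := ρ) (f := fun z => ‖z.2‖ₑ)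
    (g := fun z => edist z.1 z.2) (by fun_prop) (by fun_prop) hρ
  refine le_trans (ENNReal.rpow_le_rpow (lintegral_mono fun z => ?_) (by positivity)) h3
  refine ENNReal.rpow_le_rpow ?_ hρ0.le
  simp only [Pi.add_apply, edist_eq_enorm_sub]
  calc ‖z.1‖ₑ = ‖z.2 + (z.1 - z.2)‖ₑ := by congr 1; ring
    _ ≤ _ := enorm_add_le _ _

theorem isProbabilityMeasure_of_mem_couplings {X Y : Type*} [MeasurableSpace X]
    [MeasurableSpace Y] {α : Measure X} {β : Measure Y} [IsProbabilityMeasure α]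
    {π : Measure (X × Y)} (hπ : π ∈ couplings α β) : IsProbabilityMeasure π := by
  constructor
  rw [← Measure.fst_univ, hπ.1, measure_univ]

theorem lintegral_le_rpow_lintegral_rpow {Ω : Type*} [MeasurableSpace Ω] {m : Measure Ω}
    [IsProbabilityMeasure m] {f : Ω → ℝ≥0∞} (hf : AEMeasurable f m) {ρ : ℝ} (hρ : 1 ≤ ρ) :
    (∫⁻ ω, f ω ∂m) ≤ (∫⁻ ω, f ω ^ ρ ∂m) ^ (1 / ρ) := by
  have h := eLpNorm'_le_eLpNorm'_of_exponent_le (ε := ℝ≥0∞) one_pos hρ m hf.aestronglyMeasurable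
  simpa [eLpNorm'] using h

/-- Under any coupling the difference of means is at most the `L¹` cost, hence by Jensen at most the
`L^ρ` cost. -/
theorem enorm_integral_sub_integral_le_wasserstein {ρ : ℝ} (hρ : 1 ≤ ρ) {α β : Measure ℝ}
    [IsProbabilityMeasure α] (hα : Integrable id α) (hβ : Integrable id β) :
    ‖∫ x, x ∂α - ∫ x, x ∂β‖ₑ ≤ wasserstein ρ α β := by
  refine le_iInf₂ fun π hπ => ?_
  have := isProbabilityMeasure_of_mem_couplings hπ
  have i1 : Integrable (fun z : ℝ × ℝ => z.1) π := by
    rw [← hπ.1] at hα; exact hα.comp_measurable measurable_fst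
  have i2 : Integrable (fun z : ℝ × ℝ => z.2) π := by
    rw [← hπ.2] at hβ; exact hβ.comp_measurable measurable_snd
  have h1 : ∫ x, x ∂α = ∫ z, z.1 ∂π := by
    rw [← hπ.1, Measure.fst, integral_map measurable_fst.aemeasurable (by fun_prop)]
  have h2 : ∫ x, x ∂β = ∫ z, z.2 ∂π := by
    rw [← hπ.2, Measure.snd, integral_map measurable_snd.aemeasurable (by fun_prop)]
  rw [h1, h2, ← integral_sub i1 i2]
  refine (enorm_integral_le_lintegral_enorm _).trans ?_
  simp only [← edist_eq_enorm_sub]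
  exact lintegral_le_rpow_lintegral_rpow (by fun_prop) hρ

/-- Closeness in the Wasserstein distance bounds one quantile function by a shift of the other. -/
theorem quantile_le_quantile_add {ρ : ℝ} (hρ : 1 ≤ ρ) {α β : Measure ℝ} [IsProbabilityMeasure α]
    [IsProbabilityMeasure β] {δ : ℝ} (hδ : 0 < δ) {ε : ℝ} (hε : 0 ≤ ε)
    (h : wasserstein ρ α β < ENNReal.ofReal ε) {u v : ℝ} (hu : u ∈ Ioo (0 : ℝ) 1)
    (hv : v ∈ Ioo (0 : ℝ) 1) (huv : v + ε / δ ≤ u) : quantile β v ≤ quantile α u + δ := by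
  obtain ⟨π, hπ, hlt⟩ := by simpa only [wasserstein, iInf_lt_iff, exists_prop] using h
  have := isProbabilityMeasure_of_mem_couplings hπ
  have hc : ∫⁻ z, edist z.1 z.2 ∂π ≤ ENNReal.ofReal ε :=
    (lintegral_le_rpow_lintegral_rpow (by fun_prop) hρ).trans hlt.le
  set x := quantile α u
  rw [quantile_le_iff β hv]
  have hx : u ≤ cdf α x := (quantile_le_iff α hu x).1 le_rfl
  -- Markov's inequality: the coupling moves mass at most `ε / δ` by a distance `δ` or more, which
  -- accounts for the shift of level in `huv`.
  have hm := meas_ge_le_lintegral_div (μ := π) (f := fun z : ℝ × ℝ => edist z.1 z.2) (by fun_prop)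
    (ε := ENNReal.ofReal δ) (by simpa using hδ) ENNReal.ofReal_ne_top
  have h1 : α (Iic x) ≤ β (Iic (x + δ)) + ENNReal.ofReal (ε / δ) := by
    calc α (Iic x) = π (Prod.fst ⁻¹' Iic x) := by
          rw [← hπ.1, Measure.fst_apply measurableSet_Iic]
      _ ≤ π (Prod.snd ⁻¹' Iic (x + δ) ∪ {z | ENNReal.ofReal δ ≤ edist z.1 z.2}) := by
          refine measure_mono fun z hz => ?_
          by_cases hz' : z.2 ≤ x + δ
          · exact Or.inl hz'
          · right
            simp only [mem_preimage, mem_Iic, not_le] at hz hz'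
            rw [mem_ofPred_eq, edist_dist]
            refine ENNReal.ofReal_le_ofReal ?_
            rw [Real.dist_eq, abs_sub_comm]
            exact le_trans (by linarith) (le_abs_self _)
      _ ≤ π (Prod.snd ⁻¹' Iic (x + δ)) + π {z | ENNReal.ofReal δ ≤ edist z.1 z.2} :=
          measure_union_le _ _
      _ ≤ β (Iic (x + δ)) + ENNReal.ofReal (ε / δ) := by
          rw [← hπ.2, Measure.snd_apply measurableSet_Iic, ENNReal.ofReal_div_of_pos hδ]
          gcongr
          exact hm.trans (by gcongr)
  rw [← ofReal_cdf, ← ofReal_cdf, ← ENNReal.ofReal_add (cdf_nonneg _ _) (by positivity),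
    ENNReal.ofReal_le_ofReal_iff (add_nonneg (cdf_nonneg _ _) (by positivity))] at h1
  linarith

/-- The value at the moving level `x n` is squeezed between limit quantiles at fixed levels on
either side of `c`; continuity at `c` closes the gap. Moving levels are needed because `φ_n(u)`
varies with `n`. -/
theorem tendsto_quantile_of_tendsto_wasserstein {ρ : ℝ} (hρ : 1 ≤ ρ) {αn : ℕ → Measure ℝ}
    {α : Measure ℝ} [∀ n, IsProbabilityMeasure (αn n)] [IsProbabilityMeasure α]
    (h : Tendsto (fun n => wasserstein ρ (αn n) α) atTop (𝓝 0)) {x : ℕ → ℝ} {c : ℝ}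
    (hx : Tendsto x atTop (𝓝 c)) (hc : c ∈ Ioo (0 : ℝ) 1) (hcont : ContinuousAt (quantile α) c) :
    Tendsto (fun n => quantile (αn n) (x n)) atTop (𝓝 (quantile α c)) := by
  rw [Metric.tendsto_atTop']
  suffices H : ∀ ε > 0, ∀ᶠ n in atTop, dist (quantile (αn n) (x n)) (quantile α c) < ε by
    intro ε hε
    obtain ⟨N, hN⟩ := eventually_atTop.1 (H ε hε)
    exact ⟨N, fun n hn => hN n hn.le⟩
  intro ε hε
  obtain ⟨r, hr, hball⟩ := Metric.eventually_nhds_iff_ball.1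
    ((Metric.tendsto_nhds.1 hcont (ε / 2) (by positivity)).and (isOpen_Ioo.mem_nhds hc))
  have hlow := hball (c - r / 2) (by simp [abs_of_pos hr]; linarith)
  have hupp := hball (c + r / 2) (by simp [abs_of_pos hr]; linarith)
  -- With vertical shift `ε / 2`, this Wasserstein bound costs a level shift of `r / 4`; together
  -- with `|x n - c| < r / 4` this stays within `r / 2`.
  have hη : 0 < ε / 2 * (r / 4) := by positivity
  have e1 : ∀ᶠ n in atTop, wasserstein ρ (αn n) α < ENNReal.ofReal (ε / 2 * (r / 4)) :=
    h.eventually_lt_const (by simpa using hη)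
  have e2 := Metric.tendsto_nhds.1 hx (r / 4) (by positivity)
  have e3 := hx.eventually (isOpen_Ioo.mem_nhds hc)
  filter_upwards [e1, e2, e3] with n h1 h2 h3
  rw [Real.dist_eq, abs_lt] at h2 ⊢
  have hd : ε / 2 * (r / 4) / (ε / 2) = r / 4 := by field_simp
  have k1 := quantile_le_quantile_add hρ (half_pos hε) hη.le h1 h3 hlow.2 (by rw [hd]; linarith)
  rw [wasserstein_comm] at h1
  have k2 := quantile_le_quantile_add hρ (half_pos hε) hη.le h1 hupp.2 h3 (by rw [hd]; linarith)
  have l1 := hlow.1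
  have l2 := hupp.1
  rw [Real.dist_eq, abs_lt] at l1 l2
  constructor <;> linarith

/-! ### Convergence from almost everywhere convergence and convergence of moments -/

/-- Fatou applied to `c (|f_n|^ρ + |g|^ρ) - |f_n - g|^ρ`, which is nonnegative for `c = 2^(ρ-1)` and
converges to `2c |g|^ρ`. Upper bounds `A n` on the moments, tending to the moment of `g`, are
enough. -/
theorem tendsto_lintegral_edist_rpow_of_ae_tendsto {Ω : Type*} [MeasurableSpace Ω]
    {m : Measure Ω} {ρ : ℝ} (hρ : 1 ≤ ρ) {f : ℕ → Ω → ℝ} {g : Ω → ℝ}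
    (hf : ∀ n, Measurable (f n)) (hg : Measurable g)
    (hlim : ∀ᵐ ω ∂m, Tendsto (fun n => f n ω) atTop (𝓝 (g ω)))
    {A : ℕ → ℝ≥0∞} (hA : ∀ n, ∫⁻ ω, ‖f n ω‖ₑ ^ ρ ∂m ≤ A n)
    (hAlim : Tendsto A atTop (𝓝 (∫⁻ ω, ‖g ω‖ₑ ^ ρ ∂m))) (hfin : ∫⁻ ω, ‖g ω‖ₑ ^ ρ ∂m ≠ ∞) :
    Tendsto (fun n => ∫⁻ ω, edist (f n ω) (g ω) ^ ρ ∂m) atTop (𝓝 0) := by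
  have hρ0 : 0 < ρ := one_pos.trans_le hρ
  set c : ℝ≥0∞ := 2 ^ (ρ - 1) with hc
  have hcfin : c ≠ ∞ := ENNReal.rpow_ne_top_of_nonneg (by linarith) (by simp)
  set I := ∫⁻ ω, ‖g ω‖ₑ ^ ρ ∂m with hI
  have hdom : ∀ n ω, edist (f n ω) (g ω) ^ ρ ≤ c * (‖f n ω‖ₑ ^ ρ + ‖g ω‖ₑ ^ ρ) := by
    intro n ω
    refine le_trans (ENNReal.rpow_le_rpow ?_ hρ0.le)
      (ENNReal.rpow_add_le_mul_rpow_add_rpow _ _ hρ)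
    rw [edist_eq_enorm_sub]
    exact enorm_sub_le
  set K : ℕ → Ω → ℝ≥0∞ := fun n ω =>
    c * (‖f n ω‖ₑ ^ ρ + ‖g ω‖ₑ ^ ρ) - edist (f n ω) (g ω) ^ ρ with hK
  have hKm : ∀ n, Measurable (K n) := fun n => by
    have := hf n
    fun_prop
  have hsum : ∀ n, ∫⁻ ω, edist (f n ω) (g ω) ^ ρ ∂m + ∫⁻ ω, K n ω ∂m ≤ c * (A n + I) := by
    intro n
    rw [← lintegral_add_right _ (hKm n)]
    simp only [hK, add_tsub_cancel_of_le (hdom n _)]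
    have := hf n
    rw [lintegral_const_mul _ (by fun_prop), lintegral_add_right _ (by fun_prop)]
    gcongr
    exact hA n
  have hKlim : ∀ᵐ ω ∂m, liminf (fun n => K n ω) atTop = c * (‖g ω‖ₑ ^ ρ + ‖g ω‖ₑ ^ ρ) := by
    filter_upwards [hlim] with ω hω
    refine Tendsto.liminf_eq ?_
    have h1 : Tendsto (fun n => ‖f n ω‖ₑ ^ ρ) atTop (𝓝 (‖g ω‖ₑ ^ ρ)) :=
      (ENNReal.continuous_rpow_const.tendsto _).comp hω.enorm
    have h2 : Tendsto (fun n => edist (f n ω) (g ω) ^ ρ) atTop (𝓝 0) := by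
      have := (ENNReal.continuous_rpow_const (y := ρ)).tendsto 0
      rw [ENNReal.zero_rpow_of_pos hρ0] at this
      exact this.comp (tendsto_iff_edist_tendsto_0.1 hω)
    have h3 := ENNReal.Tendsto.sub (ENNReal.Tendsto.const_mul (a := c)
      (h1.add (tendsto_const_nhds (x := ‖g ω‖ₑ ^ ρ))) (Or.inr hcfin)) h2 (Or.inr (by simp))
    simpa using h3
  have hFatou : c * (I + I) ≤ liminf (fun n => ∫⁻ ω, K n ω ∂m) atTop := by
    calc c * (I + I) = ∫⁻ ω, liminf (fun n => K n ω) atTop ∂m := by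
          rw [lintegral_congr_ae hKlim, lintegral_const_mul _ (by fun_prop),
            lintegral_add_right _ (by fun_prop)]
      _ ≤ _ := lintegral_liminf_le hKm
  have hJ : c * (I + I) ≠ ∞ := ENNReal.mul_ne_top hcfin (ENNReal.add_ne_top.2 ⟨hfin, hfin⟩)
  rw [ENNReal.tendsto_nhds_zero]
  intro ε hε
  have hε2 : 0 < ε / 2 := ENNReal.half_pos hε.ne'
  have e1 : ∀ᶠ n in atTop, c * (I + I) ≤ ∫⁻ ω, K n ω ∂m + ε / 2 := by
    by_cases h0 : c * (I + I) = 0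
    · simp [h0]
    · have hlt : c * (I + I) - ε / 2 < liminf (fun n => ∫⁻ ω, K n ω ∂m) atTop :=
        (ENNReal.sub_lt_self hJ h0 hε2.ne').trans_le hFatou
      filter_upwards [eventually_lt_of_lt_liminf hlt] with n hn
      exact tsub_le_iff_right.1 hn.le
  have e2 : ∀ᶠ n in atTop, c * (A n + I) ≤ c * (I + I) + ε / 2 := by
    have := ENNReal.Tendsto.const_mul (a := c) (hAlim.add (tendsto_const_nhds (x := I)))
      (Or.inr hcfin)
    exact this.eventually_le_const (ENNReal.lt_add_right hJ hε2.ne')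
  have e3 : ∀ᶠ n in atTop, c * (A n + I) < ∞ := by
    have := ENNReal.Tendsto.const_mul (a := c) (hAlim.add (tendsto_const_nhds (x := I)))
      (Or.inr hcfin)
    exact this.eventually_lt_const hJ.lt_top
  filter_upwards [e1, e2, e3] with n h1 h2 h3
  have h4 : ∫⁻ ω, K n ω ∂m ≠ ∞ := ((le_add_self.trans (hsum n)).trans_lt h3).ne
  refine (ENNReal.add_le_add_iff_right h4).1 ?_
  calc _ ≤ c * (A n + I) := hsum n
    _ ≤ c * (I + I) + ε / 2 := h2
    _ ≤ (∫⁻ ω, K n ω ∂m + ε / 2) + ε / 2 := by gcongr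
    _ = ε + ∫⁻ ω, K n ω ∂m := by rw [add_assoc, ENNReal.add_halves, add_comm]

/-! ### Moments -/

theorem HasFiniteMoment.lintegral_ne_top {ρ : ℝ} (hρ : 0 < ρ) {α : Measure ℝ}
    (h : HasFiniteMoment ρ α) : ∫⁻ x, ‖x‖ₑ ^ ρ ∂α ≠ ∞ := by
  have h1 := h.integrable.2
  rw [hasFiniteIntegral_iff_enorm] at h1
  refine ne_of_lt (lt_of_eq_of_lt (lintegral_congr fun x => ?_) h1)
  rw [Real.enorm_eq_ofReal_abs, Real.enorm_of_nonneg (by positivity),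
    ENNReal.ofReal_rpow_of_nonneg (abs_nonneg x) hρ.le]

theorem HasFiniteMoment.integrable_id {ρ : ℝ} (hρ : 1 ≤ ρ) {α : Measure ℝ}
    (h : HasFiniteMoment ρ α) : Integrable id α := by
  have := h.isProbabilityMeasure
  have hρ0 : 0 < ρ := one_pos.trans_le hρ
  refine ⟨by fun_prop, ?_⟩
  rw [hasFiniteIntegral_iff_enorm]
  refine (lintegral_le_rpow_lintegral_rpow (f := fun x => ‖id x‖ₑ) (by fun_prop) hρ).trans_lt ?_
  exact ENNReal.rpow_lt_top_of_nonneg (by positivity) (h.lintegral_ne_top hρ0)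

theorem lintegral_comp_quantile (η : Measure ℝ) [IsProbabilityMeasure η] {f : ℝ → ℝ≥0∞}
    (hf : Measurable f) : ∫⁻ u, f (quantile η u) ∂unitLebesgue = ∫⁻ x, f x ∂η := by
  rw [← lintegral_map hf (measurable_quantile η), map_quantile]

theorem integral_comp_quantile (η : Measure ℝ) [IsProbabilityMeasure η] {f : ℝ → ℝ}
    (hf : Measurable f) : ∫ u, f (quantile η u) ∂unitLebesgue = ∫ x, f x ∂η := by
  rw [← integral_map (measurable_quantile η).aemeasurable hf.aestronglyMeasurable, map_quantile]

theorem integrable_quantile (η : Measure ℝ) [IsProbabilityMeasure η] (h : Integrable id η) :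
    Integrable (quantile η) unitLebesgue := by
  rw [← map_quantile η] at h
  exact h.comp_measurable (measurable_quantile η)

theorem tendsto_rpow_add_wasserstein {ρ : ℝ} (hρ : 1 ≤ ρ) (M : ℝ≥0∞) {w : ℕ → ℝ≥0∞}
    (hw : Tendsto w atTop (𝓝 0)) :
    Tendsto (fun n => (M ^ (1 / ρ) + w n) ^ ρ) atTop (𝓝 M) := by
  have hρ0 : 0 < ρ := one_pos.trans_le hρ
  have h := (ENNReal.continuous_rpow_const (y := ρ)).tendsto (M ^ (1 / ρ) + 0)
  have h' := h.comp ((tendsto_const_nhds (x := M ^ (1 / ρ))).add hw)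
  rwa [add_zero, one_div, ENNReal.rpow_inv_rpow hρ0.ne', ← one_div] at h'

theorem lintegral_enorm_rpow_le_add_wasserstein {ρ : ℝ} (hρ : 1 ≤ ρ) (α β : Measure ℝ) :
    ∫⁻ x, ‖x‖ₑ ^ ρ ∂α ≤ ((∫⁻ x, ‖x‖ₑ ^ ρ ∂β) ^ (1 / ρ) + wasserstein ρ α β) ^ ρ := by
  have hρ0 : 0 < ρ := one_pos.trans_le hρ
  have h := ENNReal.rpow_le_rpow (rpow_lintegral_enorm_le_add_wasserstein hρ α β) hρ0.le
  rwa [one_div, ENNReal.rpow_inv_rpow hρ0.ne', ← one_div] at h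

theorem ae_tendsto_quantile {ρ : ℝ} (hρ : 1 ≤ ρ) {αn : ℕ → Measure ℝ}
    {α : Measure ℝ} [∀ n, IsProbabilityMeasure (αn n)] [IsProbabilityMeasure α]
    (h : Tendsto (fun n => wasserstein ρ (αn n) α) atTop (𝓝 0)) :
    ∀ᵐ u ∂unitLebesgue, Tendsto (fun n => quantile (αn n) u) atTop (𝓝 (quantile α u)) := by
  filter_upwards [ae_continuousAt_quantile α, ae_mem_Ioo_unitLebesgue] with u hu hu'
  exact tendsto_quantile_of_tendsto_wasserstein hρ h tendsto_const_nhds hu' hu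

theorem tendsto_lintegral_edist_quantile {ρ : ℝ} (hρ : 1 ≤ ρ) {αn : ℕ → Measure ℝ}
    {α : Measure ℝ} [∀ n, IsProbabilityMeasure (αn n)] (hα : HasFiniteMoment ρ α)
    (h : Tendsto (fun n => wasserstein ρ (αn n) α) atTop (𝓝 0)) :
    Tendsto (fun n => ∫⁻ u, edist (quantile (αn n) u) (quantile α u) ∂unitLebesgue) atTop
      (𝓝 0) := by
  have := hα.isProbabilityMeasure
  have hρ0 : 0 < ρ := one_pos.trans_le hρ
  have hm : ∀ (η : Measure ℝ) [IsProbabilityMeasure η],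
      ∫⁻ u, ‖quantile η u‖ₑ ^ ρ ∂unitLebesgue = ∫⁻ x, ‖x‖ₑ ^ ρ ∂η :=
    fun η _ => lintegral_comp_quantile η (f := fun x => ‖x‖ₑ ^ ρ) (by fun_prop)
  have h1 := tendsto_lintegral_edist_rpow_of_ae_tendsto hρ
    (fun n => measurable_quantile (αn n)) (measurable_quantile α) (ae_tendsto_quantile hρ h)
    (A := fun n => ((∫⁻ x, ‖x‖ₑ ^ ρ ∂α) ^ (1 / ρ) + wasserstein ρ (αn n) α) ^ ρ)
    (fun n => (hm (αn n)).trans_le (lintegral_enorm_rpow_le_add_wasserstein hρ _ _))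
    ((hm α).symm ▸ tendsto_rpow_add_wasserstein hρ _ h)
    ((hm α).symm ▸ hα.lintegral_ne_top hρ0)
  have h2 := (ENNReal.continuous_rpow_const (y := 1 / ρ)).tendsto 0
  rw [ENNReal.zero_rpow_of_pos (by positivity)] at h2
  refine tendsto_of_tendsto_of_tendsto_of_le_of_le tendsto_const_nhds (h2.comp h1)
    (fun _ => zero_le) fun n => ?_
  have := measurable_quantile (αn n)
  have := measurable_quantile α
  exact lintegral_le_rpow_lintegral_rpow (by fun_prop) hρ

/-! ### Integrated quantile functions and the convex order -/

theorem intervalIntegrable_of_integrable_unitLebesgue {f : ℝ → ℝ} (hf : Integrable f unitLebesgue)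
    {a b : ℝ} (ha : a ∈ Icc (0 : ℝ) 1) (hb : b ∈ Icc (0 : ℝ) 1) :
    IntervalIntegrable f volume a b := by
  have h : IntegrableOn f (Ioc 0 1) := (integrableOn_Ioc_iff_integrableOn_Ioo (by simp)).2 hf
  rw [intervalIntegrable_iff]
  exact h.mono_set (Ioc_subset_Ioc (le_min ha.1 hb.1) (max_le ha.2 hb.2))

theorem integral_indicator_Iic_unitLebesgue (f : ℝ → ℝ) {u : ℝ} (hu : u ∈ Icc (0 : ℝ) 1) :
    ∫ v, (Iic u).indicator f v ∂unitLebesgue = ∫ v in (0 : ℝ)..u, f v := by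
  rw [integral_indicator measurableSet_Iic, intervalIntegral.integral_of_le hu.1,
    unitLebesgue, Measure.restrict_congr_set Ioo_ae_eq_Ioc,
    Measure.restrict_restrict measurableSet_Iic, inter_comm, Ioc_inter_Iic, min_eq_right hu.2]

theorem integral_unitLebesgue (f : ℝ → ℝ) :
    ∫ v, f v ∂unitLebesgue = ∫ v in (0 : ℝ)..1, f v := by
  rw [intervalIntegral.integral_of_le zero_le_one, unitLebesgue,
    Measure.restrict_congr_set Ioo_ae_eq_Ioc]

theorem ConvexOrder.integral_quantile_eq {μ ν : Measure ℝ} [IsProbabilityMeasure μ]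
    [IsProbabilityMeasure ν] (h : ConvexOrder μ ν) (hμ : Integrable id μ) (hν : Integrable id ν) :
    ∫ v in (0 : ℝ)..1, quantile ν v = ∫ v in (0 : ℝ)..1, quantile μ v := by
  rw [← integral_unitLebesgue, ← integral_unitLebesgue,
    integral_comp_quantile μ (f := fun x => x) measurable_id,
    integral_comp_quantile ν (f := fun x => x) measurable_id]
  have h1 := h (fun x => x) (convexOn_id convex_univ) hμ hν
  have h2 := h (fun x => -x) (concaveOn_id convex_univ).neg hμ.neg hν.neg
  rw [integral_neg, integral_neg] at h2
  linarith

/-- Test the order on the put function `x ↦ (k - x)⁺` with strike `k = F_ν⁻¹(u)`. For `ν`, its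
integral is exactly that of `k - F_ν⁻¹` over levels up to `u`; for `μ`, restricting to these levels
and dropping the positive part only decreases it. -/
theorem ConvexOrder.integral_quantile_le {μ ν : Measure ℝ} [IsProbabilityMeasure μ]
    [IsProbabilityMeasure ν] (h : ConvexOrder μ ν) (hμ : Integrable id μ) (hν : Integrable id ν)
    {u : ℝ} (hu : u ∈ Icc (0 : ℝ) 1) :
    ∫ v in (0 : ℝ)..u, quantile ν v ≤ ∫ v in (0 : ℝ)..u, quantile μ v := by
  rcases eq_or_lt_of_le hu.1 with rfl | h0
  · simp
  rcases eq_or_lt_of_le hu.2 with rfl | h1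
  · exact (h.integral_quantile_eq hμ hν).le
  have huo : u ∈ Ioo (0 : ℝ) 1 := ⟨h0, h1⟩
  have qμ := integrable_quantile μ hμ
  have qν := integrable_quantile ν hν
  set k := quantile ν u
  have hcv : ConvexOn ℝ univ fun x : ℝ => max (k - x) 0 :=
    ((convexOn_const k convex_univ).sub (concaveOn_id convex_univ)).sup
      (convexOn_const 0 convex_univ)
  have hle := h _ hcv (((integrable_const k).sub hμ).sup (integrable_const 0))
    (((integrable_const k).sub hν).sup (integrable_const 0))
  have hmeas : Measurable fun x : ℝ => max (k - x) 0 := by fun_prop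
  rw [← integral_comp_quantile μ hmeas, ← integral_comp_quantile ν hmeas] at hle
  have e1 : ∫ v, (Iic u).indicator (fun v => k - quantile μ v) v ∂unitLebesgue
      ≤ ∫ v, max (k - quantile μ v) 0 ∂unitLebesgue := by
    refine integral_mono (((integrable_const k).sub qμ).indicator measurableSet_Iic)
      (((integrable_const k).sub qμ).sup (integrable_const 0)) fun v => ?_
    by_cases hv : v ∈ Iic u
    · simp [indicator_of_mem hv]
    · simp [indicator_of_notMem hv]
  have e2 : ∫ v, max (k - quantile ν v) 0 ∂unitLebesgue
      = ∫ v, (Iic u).indicator (fun v => k - quantile ν v) v ∂unitLebesgue := by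
    refine integral_congr_ae ?_
    filter_upwards [ae_mem_Ioo_unitLebesgue] with v hv
    by_cases hvu : v ∈ Iic u
    · rw [indicator_of_mem hvu, max_eq_left]
      exact sub_nonneg.2 (monotoneOn_quantile ν hv huo hvu)
    · rw [indicator_of_notMem hvu, max_eq_right]
      exact sub_nonpos.2 (monotoneOn_quantile ν huo hv (not_le.1 hvu).le)
  have i0 : (0 : ℝ) ∈ Icc (0 : ℝ) 1 := by simp
  have e3 := (e1.trans hle).trans e2.le
  rw [integral_indicator_Iic_unitLebesgue _ hu, integral_indicator_Iic_unitLebesgue _ hu,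
    intervalIntegral.integral_sub (by simp)
      (intervalIntegrable_of_integrable_unitLebesgue qμ i0 hu),
    intervalIntegral.integral_sub (by simp)
      (intervalIntegrable_of_integrable_unitLebesgue qν i0 hu)] at e3
  linarith

/-! ### Left inverses of continuous nondecreasing functions -/

/-- A continuous nondecreasing function on `[0, 1]` starting at zero. -/
structure IsCumulative (Ψ : ℝ → ℝ) : Prop where
  continuousOn : ContinuousOn Ψ (Icc 0 1)
  monotoneOn : MonotoneOn Ψ (Icc 0 1)
  map_zero : Ψ 0 = 0

theorem zero_mem_unitInterval : (0 : ℝ) ∈ Icc (0 : ℝ) 1 := left_mem_Icc.2 zero_le_one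

theorem one_mem_unitInterval : (1 : ℝ) ∈ Icc (0 : ℝ) 1 := right_mem_Icc.2 zero_le_one

theorem IsCumulative.mem_Icc {Ψ : ℝ → ℝ} (h : IsCumulative Ψ) {u : ℝ} (hu : u ∈ Icc (0 : ℝ) 1) :
    Ψ u ∈ Icc 0 (Ψ 1) :=
  ⟨h.map_zero ▸ h.monotoneOn zero_mem_unitInterval hu hu.1,
    h.monotoneOn hu one_mem_unitInterval hu.2⟩

theorem IsCumulative.leftInverse_spec {Ψ : ℝ → ℝ} (h : IsCumulative Ψ) {r : ℝ}
    (hr : r ∈ Icc 0 (Ψ 1)) :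
    leftInverse Ψ r ∈ Icc (0 : ℝ) 1 ∧ Ψ (leftInverse Ψ r) = r ∧
      ∀ v ∈ Icc (0 : ℝ) 1, v < leftInverse Ψ r → Ψ v < r := by
  obtain ⟨w, hw, hwr⟩ : r ∈ Ψ '' Icc 0 1 :=
    intermediate_value_Icc zero_le_one h.continuousOn (by rwa [h.map_zero])
  have hbdd : BddBelow {v : ℝ | v ∈ Icc (0 : ℝ) 1 ∧ r ≤ Ψ v} := ⟨0, fun v hv => hv.1.1⟩
  have hclosed : IsClosed {v : ℝ | v ∈ Icc (0 : ℝ) 1 ∧ r ≤ Ψ v} :=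
    h.continuousOn.preimage_isClosed_of_isClosed isClosed_Icc isClosed_Ici
  have hmem : leftInverse Ψ r ∈ {v : ℝ | v ∈ Icc (0 : ℝ) 1 ∧ r ≤ Ψ v} :=
    hclosed.csInf_mem ⟨w, hw, hwr.ge⟩ hbdd
  refine ⟨hmem.1, le_antisymm ?_ hmem.2, fun v hv hlt => not_le.1 fun hle => ?_⟩
  · exact (h.monotoneOn hmem.1 hw (csInf_le hbdd ⟨hw, hwr.ge⟩)).trans hwr.le
  · exact absurd (csInf_le hbdd ⟨hv, hle⟩) (not_le.2 hlt)

/-- The strict crossing in `hlt` and `hgt` is what makes the left inverse stable: on either side of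
`c` the strict inequality passes to `Ψn`, and monotonicity traps the left inverse. -/
theorem tendsto_leftInverse {Ψn : ℕ → ℝ → ℝ} {Ψ : ℝ → ℝ} (hn : ∀ n, IsCumulative (Ψn n))
    (hlim : ∀ v ∈ Icc (0 : ℝ) 1, Tendsto (fun n => Ψn n v) atTop (𝓝 (Ψ v))) {rn : ℕ → ℝ} {r : ℝ}
    (hr : Tendsto rn atTop (𝓝 r)) (hrn : ∀ n, rn n ∈ Icc 0 (Ψn n 1)) {c : ℝ}
    (hc : c ∈ Ioo (0 : ℝ) 1) (hlt : ∀ v ∈ Icc (0 : ℝ) 1, v < c → Ψ v < r)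
    (hgt : ∀ v ∈ Icc (0 : ℝ) 1, c < v → r < Ψ v) :
    Tendsto (fun n => leftInverse (Ψn n) (rn n)) atTop (𝓝 c) := by
  rw [tendsto_order]
  constructor
  · intro a ha
    -- Truncation keeps the comparison point inside `[0, 1]`, where convergence and monotonicity are
    -- known.
    have hv : max a 0 < c := max_lt ha hc.1
    have hvm : max a 0 ∈ Icc (0 : ℝ) 1 := ⟨le_max_right _ _, (hv.trans hc.2).le⟩
    filter_upwards [(hlim _ hvm).eventually_lt hr (hlt _ hvm hv)] with n h
    obtain ⟨h1, h2, -⟩ := (hn n).leftInverse_spec (hrn n)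
    refine (le_max_left a 0).trans_lt (not_le.1 fun hle => ?_)
    exact absurd ((hn n).monotoneOn h1 hvm hle) (by rw [h2]; exact not_le.2 h)
  · intro a ha
    have hv : c < min a 1 := lt_min ha hc.2
    have hvm : min a 1 ∈ Icc (0 : ℝ) 1 := ⟨(hc.1.trans hv).le, min_le_right _ _⟩
    filter_upwards [hr.eventually_lt (hlim _ hvm) (hgt _ hvm hv)] with n h
    obtain ⟨h1, h2, -⟩ := (hn n).leftInverse_spec (hrn n)
    refine (not_le.1 fun hle => ?_ : leftInverse (Ψn n) (rn n) < _).trans_le (min_le_left a 1)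
    exact absurd ((hn n).monotoneOn hvm h1 hle) (by rw [h2]; exact not_le.2 h)

/-! ### The functions `Ψ₊` and `Ψ₋` -/

section psi

variable {a b : Measure ℝ}

theorem intervalIntegrable_max_sub (ha : Integrable (quantile a) unitLebesgue)
    (hb : Integrable (quantile b) unitLebesgue) {s t : ℝ} (hs : s ∈ Icc (0 : ℝ) 1)
    (ht : t ∈ Icc (0 : ℝ) 1) :
    IntervalIntegrable (fun v => max (quantile a v - quantile b v) 0) volume s t :=
  intervalIntegrable_of_integrable_unitLebesgue ((ha.sub hb).sup (integrable_const 0)) hs ht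

theorem psiPlus_sub_psiPlus (ha : Integrable (quantile a) unitLebesgue)
    (hb : Integrable (quantile b) unitLebesgue) {s t : ℝ} (hs : s ∈ Icc (0 : ℝ) 1)
    (ht : t ∈ Icc (0 : ℝ) 1) :
    psiPlus a b t - psiPlus a b s = ∫ v in s..t, max (quantile a v - quantile b v) 0 :=
  intervalIntegral.integral_interval_sub_left
    (intervalIntegrable_max_sub ha hb zero_mem_unitInterval ht)
    (intervalIntegrable_max_sub ha hb zero_mem_unitInterval hs)

theorem isCumulative_psiPlus (ha : Integrable (quantile a) unitLebesgue)
    (hb : Integrable (quantile b) unitLebesgue) : IsCumulative (psiPlus a b) where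
  continuousOn := by
    have h := intervalIntegral.continuousOn_primitive_interval' (a := 0) (b₁ := 0) (b₂ := 1)
      (intervalIntegrable_max_sub ha hb zero_mem_unitInterval one_mem_unitInterval)
      left_mem_uIcc
    rwa [uIcc_of_le zero_le_one] at h
  monotoneOn := fun s hs t ht hst => by
    rw [← sub_nonneg, psiPlus_sub_psiPlus ha hb hs ht]
    exact intervalIntegral.integral_nonneg hst fun _ _ => le_max_right _ _
  map_zero := intervalIntegral.integral_same

theorem psiPlus_eq_of_forall_le (ha : Integrable (quantile a) unitLebesgue)
    (hb : Integrable (quantile b) unitLebesgue) {s t : ℝ} (hs : s ∈ Icc (0 : ℝ) 1)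
    (ht : t ∈ Icc (0 : ℝ) 1) (hst : s ≤ t)
    (h : ∀ v ∈ Ioo s t, quantile a v ≤ quantile b v) : psiPlus a b s = psiPlus a b t := by
  rw [eq_comm, ← sub_eq_zero, psiPlus_sub_psiPlus ha hb hs ht,
    intervalIntegral.integral_of_le hst, integral_Ioc_eq_integral_Ioo]
  exact setIntegral_eq_zero_of_forall_eq_zero fun v hv => max_eq_right (sub_nonpos.2 (h v hv))

theorem psiPlus_lt_of_forall_lt (ha : Integrable (quantile a) unitLebesgue)
    (hb : Integrable (quantile b) unitLebesgue) {s t : ℝ} (hs : s ∈ Icc (0 : ℝ) 1)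
    (ht : t ∈ Icc (0 : ℝ) 1) (hst : s < t)
    (h : ∀ v ∈ Ioo s t, quantile b v < quantile a v) : psiPlus a b s < psiPlus a b t := by
  rw [← sub_pos, psiPlus_sub_psiPlus ha hb hs ht]
  exact intervalIntegral.intervalIntegral_pos_of_pos_on (intervalIntegrable_max_sub ha hb hs ht)
    (fun v hv => lt_max_of_lt_left (sub_pos.2 (h v hv))) hst

theorem exists_lt_of_psiPlus_lt (ha : Integrable (quantile a) unitLebesgue)
    (hb : Integrable (quantile b) unitLebesgue) {s t : ℝ} (hs : s ∈ Icc (0 : ℝ) 1)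
    (ht : t ∈ Icc (0 : ℝ) 1) (hst : s ≤ t) (h : psiPlus a b s < psiPlus a b t) :
    ∃ v ∈ Ioo s t, quantile b v < quantile a v := by
  by_contra! hc
  exact h.ne (psiPlus_eq_of_forall_le ha hb hs ht hst hc)

/-- The levels `u` at which both quantile functions are continuous and `F_b⁻¹(u) < F_a⁻¹(u)`. -/
def exceedSet (a b : Measure ℝ) : Set ℝ :=
  {u | u ∈ Ioo (0 : ℝ) 1 ∧ ContinuousAt (quantile a) u ∧ ContinuousAt (quantile b) u ∧
    quantile b u < quantile a u}

theorem exceedSet.exists_interval {u : ℝ} (hu : u ∈ exceedSet a b) :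
    ∃ s t, s ∈ Icc (0 : ℝ) 1 ∧ t ∈ Icc (0 : ℝ) 1 ∧ s < u ∧ u < t ∧
      ∀ v ∈ Ioo s t, quantile b v < quantile a v := by
  obtain ⟨hu1, hca, hcb, hlt⟩ := hu
  have h := (hcb.eventually_lt hca hlt).and (isOpen_Ioo.mem_nhds hu1)
  obtain ⟨s, t, hst, hsub⟩ := mem_nhds_iff_exists_Ioo_subset.1 h
  refine ⟨max s 0, min t 1, ⟨le_max_right _ _, ?_⟩, ⟨?_, min_le_right _ _⟩, max_lt hst.1 hu1.1,
    lt_min hst.2 hu1.2, fun v hv => (hsub ⟨?_, ?_⟩).1⟩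
  · exact (max_lt hst.1 hu1.1).le.trans hu1.2.le
  · exact hu1.1.le.trans (lt_min hst.2 hu1.2).le
  · exact (le_max_left _ _).trans_lt hv.1
  · exact hv.2.trans_le (min_le_left _ _)

/-- Continuity at `u` spreads the strict inequality of quantiles to an interval ending at `u`, on
which the integrand is positive. -/
theorem psiPlus_lt_of_lt_of_mem_exceedSet (ha : Integrable (quantile a) unitLebesgue)
    (hb : Integrable (quantile b) unitLebesgue) {u v : ℝ} (hu : u ∈ exceedSet a b)
    (hv : v ∈ Icc (0 : ℝ) 1) (hvu : v < u) : psiPlus a b v < psiPlus a b u := by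
  obtain ⟨s, t, hs, ht, hsu, hut, h⟩ := exceedSet.exists_interval hu
  have hm : max s v ∈ Icc (0 : ℝ) 1 := ⟨hs.1.trans (le_max_left _ _), max_le hs.2 hv.2⟩
  exact ((isCumulative_psiPlus ha hb).monotoneOn hv hm (le_max_right _ _)).trans_lt
    (psiPlus_lt_of_forall_lt ha hb hm (Ioo_subset_Icc_self hu.1) (max_lt hsu hvu)
      fun w hw => h w ⟨(le_max_left _ _).trans_lt hw.1, hw.2.trans hut⟩)

theorem injOn_psiPlus_exceedSet (ha : Integrable (quantile a) unitLebesgue)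
    (hb : Integrable (quantile b) unitLebesgue) : InjOn (psiPlus a b) (exceedSet a b) := by
  intro u hu v hv huv
  rcases lt_trichotomy u v with h | h | h
  · exact absurd huv (psiPlus_lt_of_lt_of_mem_exceedSet ha hb hv (Ioo_subset_Icc_self hu.1) h).ne
  · exact h
  · exact absurd huv (psiPlus_lt_of_lt_of_mem_exceedSet ha hb hu (Ioo_subset_Icc_self hv.1) h).ne'

theorem leftInverse_psiPlus_psiPlus (ha : Integrable (quantile a) unitLebesgue)
    (hb : Integrable (quantile b) unitLebesgue) {u : ℝ} (hu : u ∈ exceedSet a b) :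
    leftInverse (psiPlus a b) (psiPlus a b u) = u := by
  have hc := isCumulative_psiPlus ha hb
  have huI := Ioo_subset_Icc_self hu.1
  obtain ⟨h1, h2, h3⟩ := hc.leftInverse_spec (hc.mem_Icc huI)
  rcases lt_trichotomy (leftInverse (psiPlus a b) (psiPlus a b u)) u with h | h | h
  · exact absurd h2 (psiPlus_lt_of_lt_of_mem_exceedSet ha hb hu h1 h).ne
  · exact h
  · exact absurd (h3 u huI h) (lt_irrefl _)

end psi

/-- `Ψ₋ ≤ Ψ₊` with equality at `1`: the convex order in terms of quantile functions. -/
structure QuantileDominated (μ ν : Measure ℝ) : Prop where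
  integrable_left : Integrable (quantile μ) unitLebesgue
  integrable_right : Integrable (quantile ν) unitLebesgue
  le : ∀ u ∈ Icc (0 : ℝ) 1, psiPlus ν μ u ≤ psiPlus μ ν u
  eq : psiPlus ν μ 1 = psiPlus μ ν 1

theorem psiPlus_sub_psiMinus {μ ν : Measure ℝ} (hμ : Integrable (quantile μ) unitLebesgue)
    (hν : Integrable (quantile ν) unitLebesgue) {u : ℝ} (hu : u ∈ Icc (0 : ℝ) 1) :
    psiPlus μ ν u - psiPlus ν μ u
      = (∫ v in (0 : ℝ)..u, quantile μ v) - ∫ v in (0 : ℝ)..u, quantile ν v := by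
  rw [psiPlus, psiPlus, ← intervalIntegral.integral_sub
    (intervalIntegrable_max_sub hμ hν zero_mem_unitInterval hu)
    (intervalIntegrable_max_sub hν hμ zero_mem_unitInterval hu),
    ← intervalIntegral.integral_sub
    (intervalIntegrable_of_integrable_unitLebesgue hμ zero_mem_unitInterval hu)
    (intervalIntegrable_of_integrable_unitLebesgue hν zero_mem_unitInterval hu)]
  refine intervalIntegral.integral_congr fun v _ => ?_
  rcases le_total (quantile μ v) (quantile ν v) with h | h
  · simp [max_eq_right (sub_nonpos.2 h), max_eq_left (sub_nonneg.2 h)]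
  · simp [max_eq_right (sub_nonpos.2 h), max_eq_left (sub_nonneg.2 h)]

theorem ConvexOrder.quantileDominated {μ ν : Measure ℝ} [IsProbabilityMeasure μ]
    [IsProbabilityMeasure ν] (h : ConvexOrder μ ν) (hμ : Integrable id μ)
    (hν : Integrable id ν) : QuantileDominated μ ν where
  integrable_left := integrable_quantile μ hμ
  integrable_right := integrable_quantile ν hν
  le u hu := by
    rw [← sub_nonneg, psiPlus_sub_psiMinus (integrable_quantile μ hμ) (integrable_quantile ν hν) hu,
      sub_nonneg]
    exact h.integral_quantile_le hμ hν hu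
  eq := by
    rw [eq_comm, ← sub_eq_zero, psiPlus_sub_psiMinus (integrable_quantile μ hμ)
      (integrable_quantile ν hν) one_mem_unitInterval, h.integral_quantile_eq hμ hν, sub_self]

/-- The positive part is 1-Lipschitz, so `L¹` convergence of the quantile functions passes to the
integrals. -/
theorem tendsto_psiPlus {an bn : ℕ → Measure ℝ} {a b : Measure ℝ}
    (han : ∀ n, Integrable (quantile (an n)) unitLebesgue)
    (hbn : ∀ n, Integrable (quantile (bn n)) unitLebesgue)
    (ha : Integrable (quantile a) unitLebesgue) (hb : Integrable (quantile b) unitLebesgue)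
    (hla : Tendsto (fun n => ∫⁻ u, edist (quantile (an n) u) (quantile a u) ∂unitLebesgue) atTop
      (𝓝 0))
    (hlb : Tendsto (fun n => ∫⁻ u, edist (quantile (bn n) u) (quantile b u) ∂unitLebesgue) atTop
      (𝓝 0)) {u : ℝ} (hu : u ∈ Icc (0 : ℝ) 1) :
    Tendsto (fun n => psiPlus (an n) (bn n) u) atTop (𝓝 (psiPlus a b u)) := by
  have hcongr : ∀ c d : Measure ℝ, psiPlus c d u
      = ∫ v, (Iic u).indicator (fun v => max (quantile c v - quantile d v) 0) v ∂unitLebesgue :=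
    fun c d => (integral_indicator_Iic_unitLebesgue _ hu).symm
  simp only [hcongr]
  refine tendsto_integral_of_L1 _ (((ha.sub hb).sup (integrable_const 0)).indicator
    measurableSet_Iic).aestronglyMeasurable (Eventually.of_forall fun n => (((han n).sub (hbn n)).sup
      (integrable_const 0)).indicator measurableSet_Iic) ?_
  have hsum := hla.add hlb
  rw [add_zero] at hsum
  refine tendsto_of_tendsto_of_tendsto_of_le_of_le tendsto_const_nhds hsum (fun _ => zero_le)
    fun n => ?_
  have m1 := measurable_quantile (an n)
  have m2 := measurable_quantile a
  rw [← lintegral_add_left (by fun_prop)]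
  refine lintegral_mono fun v => ?_
  by_cases hv : v ∈ Iic u
  · simp only [indicator_of_mem hv, edist_dist, ← ENNReal.ofReal_add dist_nonneg dist_nonneg,
      ← ofReal_norm]
    refine ENNReal.ofReal_le_ofReal ?_
    rw [Real.norm_eq_abs, Real.dist_eq, Real.dist_eq]
    refine (abs_max_sub_max_le_abs _ _ _).trans ?_
    calc |quantile (an n) v - quantile (bn n) v - (quantile a v - quantile b v)|
        = |(quantile (an n) v - quantile a v) - (quantile (bn n) v - quantile b v)| := by ring_nf
      _ ≤ _ := abs_sub _ _
  · simp [indicator_of_notMem hv]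

/-- The order is inherited by the limit through `Ψ±`, so it need not be assumed for `(μ, ν)`. -/
theorem QuantileDominated.of_tendsto {μn νn : ℕ → Measure ℝ} {μ ν : Measure ℝ}
    (hn : ∀ n, QuantileDominated (μn n) (νn n)) (hμ : Integrable (quantile μ) unitLebesgue)
    (hν : Integrable (quantile ν) unitLebesgue)
    (h1 : ∀ u ∈ Icc (0 : ℝ) 1, Tendsto (fun n => psiPlus (μn n) (νn n) u) atTop
      (𝓝 (psiPlus μ ν u)))
    (h2 : ∀ u ∈ Icc (0 : ℝ) 1, Tendsto (fun n => psiPlus (νn n) (μn n) u) atTop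
      (𝓝 (psiPlus ν μ u))) : QuantileDominated μ ν where
  integrable_left := hμ
  integrable_right := hν
  le u hu := le_of_tendsto_of_tendsto' (h2 u hu) (h1 u hu) fun n => (hn n).le u hu
  eq := tendsto_nhds_unique (h2 1 one_mem_unitInterval)
    ((h1 1 one_mem_unitInterval).congr fun n => (hn n).eq.symm)

/-! ### The matching of levels and the weight -/

/-- The level `c` is matched with `u ∈ exceedSet a b`: it is the only solution of
`psiPlus b a c = psiPlus a b u`, and the quantile functions are continuous there. -/
structure IsMatched (a b : Measure ℝ) (u c : ℝ) : Prop where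
  left_mem : u ∈ exceedSet a b
  right_mem : c ∈ Ioo (0 : ℝ) 1
  continuousAt_left : ContinuousAt (quantile a) c
  continuousAt_right : ContinuousAt (quantile b) c
  eq : psiPlus b a c = psiPlus a b u
  lt : ∀ v ∈ Icc (0 : ℝ) 1, v < c → psiPlus b a v < psiPlus a b u
  gt : ∀ v ∈ Icc (0 : ℝ) 1, c < v → psiPlus a b u < psiPlus b a v

section matching

variable {a b μ ν : Measure ℝ}

/-- A level `u` can fail only if `psiPlus a b u` lies in the image of a countable set `T`. Since
`psiPlus a b` is injective on `exceedSet a b`, only countably many `u` fail. -/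
theorem ae_isMatched (ha : Integrable (quantile a) unitLebesgue)
    (hb : Integrable (quantile b) unitLebesgue) (h1 : psiPlus a b 1 = psiPlus b a 1) :
    ∀ᵐ u ∂unitLebesgue, u ∈ exceedSet a b →
      IsMatched a b u (leftInverse (psiPlus b a) (psiPlus a b u)) := by
  -- The rationals serve twice: they contain the endpoints 0 and 1, and any flat stretch of `psiPlus
  -- b a` contains one, so avoiding them forces a strict crossing.
  set T : Set ℝ := range ((↑) : ℚ → ℝ) ∪
    ({u | u ∈ Ioo (0 : ℝ) 1 ∧ ¬ ContinuousAt (quantile a) u} ∪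
      {u | u ∈ Ioo (0 : ℝ) 1 ∧ ¬ ContinuousAt (quantile b) u}) with hT
  have hTc : T.Countable := (countable_range _).union
    ((countable_not_continuousAt_quantile a).union (countable_not_continuousAt_quantile b))
  have hbad : {u | u ∈ exceedSet a b ∧ psiPlus a b u ∈ psiPlus b a '' T}.Countable := by
    refine countable_of_injective_of_countable_image (f := psiPlus a b) ?_
      ((hTc.image (psiPlus b a)).mono ?_)
    · exact (injOn_psiPlus_exceedSet ha hb).mono fun u hu => hu.1
    · rintro _ ⟨u, hu, rfl⟩
      exact hu.2
  have hae : ∀ᵐ u ∂unitLebesgue, u ∉ {u | u ∈ exceedSet a b ∧ psiPlus a b u ∈ psiPlus b a '' T} :=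
    ae_restrict_of_ae (s := Ioo (0 : ℝ) 1) (hbad.ae_notMem volume)
  filter_upwards [hae] with u hu hmem
  have hab := isCumulative_psiPlus ha hb
  have hba := isCumulative_psiPlus hb ha
  have hr : psiPlus a b u ∈ Icc 0 (psiPlus b a 1) := by
    rw [← h1]
    exact hab.mem_Icc (Ioo_subset_Icc_self hmem.1)
  obtain ⟨k1, k2, k3⟩ := hba.leftInverse_spec hr
  set c := leftInverse (psiPlus b a) (psiPlus a b u)
  have hnot : ∀ v, psiPlus b a v = psiPlus a b u → v ∉ T := fun v hv hvT =>
    hu ⟨hmem, v, hvT, hv⟩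
  have hcT := hnot c k2
  have hcm : c ∈ Ioo (0 : ℝ) 1 := by
    refine ⟨lt_of_le_of_ne k1.1 ?_, lt_of_le_of_ne k1.2 ?_⟩
    · rintro h0
      exact hcT (Or.inl ⟨0, by rw [← h0]; simp⟩)
    · rintro h0
      exact hcT (Or.inl ⟨1, by rw [h0]; simp⟩)
  refine ⟨hmem, hcm, ?_, ?_, k2, k3, fun v hv hcv => ?_⟩
  · by_contra hcont
    exact hcT (Or.inr (Or.inl ⟨hcm, hcont⟩))
  · by_contra hcont
    exact hcT (Or.inr (Or.inr ⟨hcm, hcont⟩))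
  · obtain ⟨q, hq1, hq2⟩ := exists_rat_btwn hcv
    have hqm : (q : ℝ) ∈ Icc (0 : ℝ) 1 := ⟨(hcm.1.trans hq1).le, hq2.le.trans hv.2⟩
    have h4 : psiPlus a b u ≤ psiPlus b a q := k2 ▸ hba.monotoneOn k1 hqm hq1.le
    have h5 : psiPlus a b u ≠ psiPlus b a q := fun h => hnot q h.symm (Or.inl ⟨q, rfl⟩)
    exact (lt_of_le_of_ne h4 h5).trans_le (hba.monotoneOn hqm hv hq2.le)

/-- Just left of `u`, `Ψ₋` is flat while `Ψ₊` strictly increases, and `Ψ₋ ≤ Ψ₊` already holds at the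
start of that stretch. -/
theorem QuantileDominated.psi_lt_of_mem_left (h : QuantileDominated μ ν) {u : ℝ}
    (hu : u ∈ exceedSet μ ν) : psiPlus ν μ u < psiPlus μ ν u := by
  obtain ⟨s, t, hs, ht, hsu, hut, hlt⟩ := exceedSet.exists_interval hu
  have hI := Ioo_subset_Icc_self hu.1
  rw [← psiPlus_eq_of_forall_le h.integrable_right h.integrable_left hs hI hsu.le
    fun v hv => (hlt v ⟨hv.1, hv.2.trans hut⟩).le]
  exact (h.le s hs).trans_lt
    (psiPlus_lt_of_lt_of_mem_exceedSet h.integrable_left h.integrable_right hu hs hsu)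

/-- Here the comparison is made to the right of `u`: `Ψ₊` is flat there, and `Ψ₋` still has to
increase strictly without overtaking it. -/
theorem QuantileDominated.psi_lt_of_mem_right (h : QuantileDominated μ ν) {u : ℝ}
    (hu : u ∈ exceedSet ν μ) : psiPlus ν μ u < psiPlus μ ν u := by
  obtain ⟨s, t, hs, ht, hsu, hut, hlt⟩ := exceedSet.exists_interval hu
  have hI := Ioo_subset_Icc_self hu.1
  rw [psiPlus_eq_of_forall_le h.integrable_left h.integrable_right hI ht hut.le
    fun v hv => (hlt v ⟨hsu.trans hv.1, hv.2⟩).le]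
  exact (psiPlus_lt_of_forall_lt h.integrable_right h.integrable_left hI ht hut
    fun v hv => hlt v ⟨hsu.trans hv.1, hv.2⟩).trans_le (h.le t ht)

/-- From `Ψ₋(u) < Ψ₊(u) = Ψ₋(c)` one gets `u < c`, and `Ψ₋` increases between them. So some `v` in
between has `F_μ⁻¹(v) < F_ν⁻¹(v)`, and monotonicity of both quantile functions concludes. -/
theorem IsMatched.quantile_lt_of_left (h : QuantileDominated μ ν) {u c : ℝ}
    (hm : IsMatched μ ν u c) : quantile μ u < quantile ν c := by
  have hI := Ioo_subset_Icc_self hm.left_mem.1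
  have hcI := Ioo_subset_Icc_self hm.right_mem
  have huc : u < c := by
    by_contra! hle
    have := (isCumulative_psiPlus h.integrable_right h.integrable_left).monotoneOn hcI hI hle
    rw [hm.eq] at this
    exact absurd this (not_le.2 (h.psi_lt_of_mem_left hm.left_mem))
  obtain ⟨v, hv, hlt⟩ := exists_lt_of_psiPlus_lt h.integrable_right h.integrable_left hI hcI huc.le
    (hm.eq ▸ hm.lt u hI huc)
  have hvI : v ∈ Ioo (0 : ℝ) 1 := ⟨hm.left_mem.1.1.trans hv.1, hv.2.trans hm.right_mem.2⟩
  exact (monotoneOn_quantile μ hm.left_mem.1 hvI hv.1.le).trans_lt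
    (hlt.trans_le (monotoneOn_quantile ν hvI hm.right_mem hv.2.le))

theorem IsMatched.quantile_lt_of_right (h : QuantileDominated μ ν) {u c : ℝ}
    (hm : IsMatched ν μ u c) : quantile ν c < quantile μ u := by
  have hI := Ioo_subset_Icc_self hm.left_mem.1
  have hcI := Ioo_subset_Icc_self hm.right_mem
  have hcu : c < u := by
    by_contra! hle
    have := (isCumulative_psiPlus h.integrable_left h.integrable_right).monotoneOn hI hcI hle
    rw [hm.eq] at this
    exact absurd this (not_le.2 (h.psi_lt_of_mem_right hm.left_mem))
  obtain ⟨v, hv, hlt⟩ := exists_lt_of_psiPlus_lt h.integrable_left h.integrable_right hcI hI hcu.le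
    (hm.eq ▸ hm.gt u hI hcu)
  have hvI : v ∈ Ioo (0 : ℝ) 1 := ⟨hm.right_mem.1.trans hv.1, hv.2.trans hm.left_mem.1.2⟩
  exact (monotoneOn_quantile ν hm.right_mem hvI hv.1.le).trans_lt
    (hlt.trans_le (monotoneOn_quantile μ hvI hm.left_mem.1 hv.2.le))

theorem phi_of_lt {u : ℝ} (h : quantile ν u < quantile μ u) :
    phi μ ν u = leftInverse (psiPlus ν μ) (psiPlus μ ν u) := by
  rw [phi, if_pos h]; rfl

theorem phi_of_gt {u : ℝ} (h : quantile μ u < quantile ν u) :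
    phi μ ν u = leftInverse (psiPlus μ ν) (psiPlus ν μ u) := by
  rw [phi, if_neg h.not_gt, if_pos h]; rfl

theorem weight_of_ne {u : ℝ} (h : quantile μ u ≠ quantile ν u) :
    weight μ ν u = (quantile μ u - quantile ν u) / (quantile ν (phi μ ν u) - quantile ν u) := by
  rw [weight, if_pos h]

theorem weight_of_eq {u : ℝ} (h : quantile μ u = quantile ν u) : weight μ ν u = 0 := by
  rw [weight, if_neg (not_not.2 h)]

/-- The three cases for a level `u`: matched to a level above, matched to a level below, or
unmoved. -/
theorem QuantileDominated.ae_trichotomy (h : QuantileDominated μ ν) :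
    ∀ᵐ u ∂unitLebesgue, IsMatched μ ν u (phi μ ν u) ∨ IsMatched ν μ u (phi μ ν u) ∨
      quantile μ u = quantile ν u := by
  filter_upwards [ae_isMatched h.integrable_left h.integrable_right h.eq.symm,
    ae_isMatched h.integrable_right h.integrable_left h.eq, ae_mem_Ioo_unitLebesgue,
    ae_continuousAt_quantile μ, ae_continuousAt_quantile ν] with u h1 h2 hu hcμ hcν
  rcases lt_trichotomy (quantile μ u) (quantile ν u) with hlt | heq | hgt
  · rw [phi_of_gt hlt]
    exact Or.inr (Or.inl (h2 ⟨hu, hcν, hcμ, hlt⟩))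
  · exact Or.inr (Or.inr heq)
  · rw [phi_of_lt hgt]
    exact Or.inl (h1 ⟨hu, hcμ, hcν, hgt⟩)

/-- `F_μ⁻¹(u)` lies between the two atoms. The product form is the martingale property, and remains
meaningful where the quantiles agree and the weight is zero. -/
theorem QuantileDominated.ae_weight (h : QuantileDominated μ ν) :
    ∀ᵐ u ∂unitLebesgue, weight μ ν u ∈ Icc (0 : ℝ) 1 ∧
      weight μ ν u * (quantile ν (phi μ ν u) - quantile ν u) = quantile μ u - quantile ν u := by
  filter_upwards [h.ae_trichotomy] with u hu
  rcases hu with hm | hm | heq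
  · have h1 := hm.left_mem.2.2.2
    have h2 := hm.quantile_lt_of_left h
    have h3 : 0 < quantile ν (phi μ ν u) - quantile ν u := by linarith
    rw [weight_of_ne h1.ne', div_mul_cancel₀ _ h3.ne']
    refine ⟨⟨div_nonneg (by linarith) h3.le, (div_le_one h3).2 (by linarith)⟩, rfl⟩
  · have h1 := hm.left_mem.2.2.2
    have h2 := hm.quantile_lt_of_right h
    have h3 : quantile ν (phi μ ν u) - quantile ν u < 0 := by linarith
    rw [weight_of_ne h1.ne, div_mul_cancel₀ _ h3.ne]
    refine ⟨⟨div_nonneg_of_nonpos (by linarith) h3.le, (div_le_one_of_neg h3).2 (by linarith)⟩, rfl⟩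
  · simp [weight_of_eq heq, heq]

end matching

/-! ### The second marginal -/

/-- Change of variables along the integrated positive part. -/
theorem lintegral_comp_psiPlus {a b : Measure ℝ} (ha : Integrable (quantile a) unitLebesgue)
    (hb : Integrable (quantile b) unitLebesgue) {G : ℝ → ℝ≥0∞} (hG : Measurable G) :
    ∫⁻ u, ENNReal.ofReal (quantile a u - quantile b u) * G (psiPlus a b u) ∂unitLebesgue
      = ∫⁻ r in Ioc 0 (psiPlus a b 1), G r := by
  have hC := isCumulative_psiPlus ha hb
  set d : ℝ → ℝ≥0∞ := fun u => ENNReal.ofReal (quantile a u - quantile b u) with hd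
  have hdm : Measurable d := ((measurable_quantile a).sub (measurable_quantile b)).ennreal_ofReal
  have hdi : ∀ t ∈ Icc (0 : ℝ) 1, ∫⁻ v in Ioc 0 t, d v = ENNReal.ofReal (psiPlus a b t) := by
    intro t ht
    rw [psiPlus, intervalIntegral.integral_of_le ht.1, ofReal_integral_eq_lintegral_ofReal]
    · refine lintegral_congr fun v => ?_
      simp [hd, ENNReal.ofReal_max]
    · exact (intervalIntegrable_max_sub ha hb zero_mem_unitInterval ht).1
    · exact Eventually.of_forall fun _ => le_max_right _ _
  have huniv : ∫⁻ v, d v ∂unitLebesgue = ENNReal.ofReal (psiPlus a b 1) := by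
    rw [← hdi 1 one_mem_unitInterval, unitLebesgue, Measure.restrict_congr_set Ioo_ae_eq_Ioc]
  have hfin : IsFiniteMeasure (unitLebesgue.withDensity d) :=
    isFiniteMeasure_withDensity (by rw [huniv]; exact ENNReal.ofReal_ne_top)
  have hmap : (unitLebesgue.withDensity d).map (psiPlus a b)
      = volume.restrict (Ioc 0 (psiPlus a b 1)) := by
    refine Measure.ext_of_Iic _ _ fun r => ?_
    rw [Measure.map_apply (measurable_psiPlus a b) measurableSet_Iic,
      Measure.restrict_apply measurableSet_Iic, inter_comm, Ioc_inter_Iic, Real.volume_Ioc,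
      sub_zero, withDensity_apply _ (measurable_psiPlus a b measurableSet_Iic)]
    rcases lt_or_ge r 0 with hr0 | hr0
    · rw [ENNReal.ofReal_of_nonpos ((min_le_right _ _).trans hr0.le), unitLebesgue,
        Measure.restrict_restrict (measurable_psiPlus a b measurableSet_Iic)]
      have : psiPlus a b ⁻¹' Iic r ∩ Ioo 0 1 = ∅ := by
        ext v
        simp only [mem_inter_iff, mem_preimage, mem_Iic, mem_empty_iff_false, iff_false, not_and]
        intro hv hv'
        exact absurd ((hC.mem_Icc (Ioo_subset_Icc_self hv')).1.trans hv) (not_le.2 hr0)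
      rw [this]; simp
    -- With `s` the last point where `psiPlus a b` is at most `r`, the sublevel set in `(0, 1]` is
    -- exactly `(0, s]`, so no strict monotonicity is needed.
    obtain ⟨s, hs, hsmax⟩ : ∃ s, IsGreatest (Icc 0 1 ∩ psiPlus a b ⁻¹' Iic r) s :=
      (isCompact_Icc.of_isClosed_subset
        (hC.continuousOn.preimage_isClosed_of_isClosed isClosed_Icc isClosed_Iic)
        inter_subset_left).exists_isGreatest
        ⟨0, zero_mem_unitInterval, by simpa [hC.map_zero] using hr0⟩
    have hsr : min (psiPlus a b 1) r = psiPlus a b s := by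
      rcases le_total (psiPlus a b 1) r with hr1 | hr1
      · rw [min_eq_left hr1, le_antisymm hs.1.2 (hsmax ⟨one_mem_unitInterval, hr1⟩)]
      · obtain ⟨w, hw, hwr⟩ : r ∈ psiPlus a b '' Icc 0 1 :=
          intermediate_value_Icc zero_le_one hC.continuousOn ⟨by rwa [hC.map_zero], hr1⟩
        rw [min_eq_right hr1]
        exact le_antisymm (hwr ▸ hC.monotoneOn hw hs.1 (hsmax ⟨hw, hwr.le⟩)) hs.2
    rw [hsr, ← hdi s hs.1, unitLebesgue, Measure.restrict_congr_set Ioo_ae_eq_Ioc,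
      Measure.restrict_restrict (measurable_psiPlus a b measurableSet_Iic)]
    congr 2
    ext v
    constructor
    · exact fun hv => ⟨hv.2.1, hsmax ⟨Ioc_subset_Icc_self hv.2, hv.1⟩⟩
    · intro hv
      have hv1 : v ∈ Ioc (0 : ℝ) 1 := ⟨hv.1, hv.2.trans hs.1.2⟩
      exact ⟨(hC.monotoneOn (Ioc_subset_Icc_self hv1) hs.1 hv.2).trans hs.2, hv1⟩
  rw [← hmap, lintegral_map hG (measurable_psiPlus a b),
    lintegral_withDensity_eq_lintegral_mul (g := fun u => G (psiPlus a b u)) _ hdm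
      (hG.comp (measurable_psiPlus a b))]
  rfl

section marginal

variable {μ ν : Measure ℝ}

/-- The reciprocal of the distance between the atoms matched at mass level `r`. -/
def inverseGap (μ ν : Measure ℝ) (r : ℝ) : ℝ≥0∞ :=
  (ENNReal.ofReal (quantile ν (leftInverse (psiPlus ν μ) r)
    - quantile ν (leftInverse (psiPlus μ ν) r)))⁻¹

theorem measurable_inverseGap (μ ν : Measure ℝ) : Measurable (inverseGap μ ν) :=
  ((((measurable_quantile ν).comp (measurable_leftInverse _)).sub
    ((measurable_quantile ν).comp (measurable_leftInverse _))).ennreal_ofReal).inv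

/-- At `r = Ψ₊(u)` the two left inverses return `u` and `φ(u)`, so the denominator depends on `r`
alone. The levels below their match and those above it share the same `inverseGap`. -/
theorem QuantileDominated.ofReal_weight_of_left (h : QuantileDominated μ ν) {u : ℝ}
    (hm : IsMatched μ ν u (phi μ ν u)) :
    ENNReal.ofReal (weight μ ν u)
      = ENNReal.ofReal (quantile μ u - quantile ν u) * inverseGap μ ν (psiPlus μ ν u) := by
  have h1 := hm.left_mem.2.2.2
  have h2 := hm.quantile_lt_of_left h
  rw [weight_of_ne h1.ne', ENNReal.ofReal_div_of_pos (by linarith), inverseGap,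
    leftInverse_psiPlus_psiPlus h.integrable_left h.integrable_right hm.left_mem, ← phi_of_lt h1,
    div_eq_mul_inv]

theorem QuantileDominated.ofReal_weight_of_right (h : QuantileDominated μ ν) {u : ℝ}
    (hm : IsMatched ν μ u (phi μ ν u)) :
    ENNReal.ofReal (weight μ ν u)
      = ENNReal.ofReal (quantile ν u - quantile μ u) * inverseGap μ ν (psiPlus ν μ u) := by
  have h1 := hm.left_mem.2.2.2
  have h2 := hm.quantile_lt_of_right h
  rw [weight_of_ne h1.ne, ← neg_div_neg_eq, neg_sub, neg_sub,
    ENNReal.ofReal_div_of_pos (by linarith), inverseGap,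
    leftInverse_psiPlus_psiPlus h.integrable_right h.integrable_left hm.left_mem, ← phi_of_gt h1,
    div_eq_mul_inv]

theorem QuantileDominated.lintegral_weight_mul (h : QuantileDominated μ ν) {A B F : ℝ → ℝ≥0∞}
    (hA : Measurable A) (hB : Measurable B)
    (hFA : ∀ u, IsMatched μ ν u (phi μ ν u) → F u = A (psiPlus μ ν u))
    (hFB : ∀ u, IsMatched ν μ u (phi μ ν u) → F u = B (psiPlus ν μ u)) :
    ∫⁻ u, ENNReal.ofReal (weight μ ν u) * F u ∂unitLebesgue
      = (∫⁻ r in Ioc 0 (psiPlus μ ν 1), inverseGap μ ν r * A r)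
        + ∫⁻ r in Ioc 0 (psiPlus μ ν 1), inverseGap μ ν r * B r := by
  have hg := measurable_inverseGap μ ν
  have hmA : Measurable fun r => inverseGap μ ν r * A r := hg.mul hA
  have hmB : Measurable fun r => inverseGap μ ν r * B r := hg.mul hB
  rw [← lintegral_comp_psiPlus h.integrable_left h.integrable_right hmA, ← h.eq,
    ← lintegral_comp_psiPlus h.integrable_right h.integrable_left hmB, ← lintegral_add_left]
  · refine lintegral_congr_ae ?_
    filter_upwards [h.ae_trichotomy] with u hu
    rcases hu with hm | hm | heq
    · have h0 : ENNReal.ofReal (quantile ν u - quantile μ u) = 0 :=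
        ENNReal.ofReal_of_nonpos (sub_nonpos.2 hm.left_mem.2.2.2.le)
      rw [h.ofReal_weight_of_left hm, hFA u hm, h0, zero_mul, add_zero, mul_assoc]
    · have h0 : ENNReal.ofReal (quantile μ u - quantile ν u) = 0 :=
        ENNReal.ofReal_of_nonpos (sub_nonpos.2 hm.left_mem.2.2.2.le)
      rw [h.ofReal_weight_of_right hm, hFB u hm, h0, zero_mul, zero_add, mul_assoc]
    · simp [weight_of_eq heq, heq]
  · exact (((measurable_quantile μ).sub (measurable_quantile ν)).ennreal_ofReal).mul
      (hmA.comp (measurable_psiPlus μ ν))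

/-- The mass moved away from the levels by the weight equals the mass moved onto them. -/
theorem QuantileDominated.lintegral_weight_mul_comp_phi (h : QuantileDominated μ ν)
    {f : ℝ → ℝ≥0∞} (hf : Measurable f) :
    ∫⁻ u, ENNReal.ofReal (weight μ ν u) * f (quantile ν (phi μ ν u)) ∂unitLebesgue
      = ∫⁻ u, ENNReal.ofReal (weight μ ν u) * f (quantile ν u) ∂unitLebesgue := by
  have hm : ∀ Ψ : ℝ → ℝ, Measurable fun r => f (quantile ν (leftInverse Ψ r)) := fun Ψ =>
    hf.comp ((measurable_quantile ν).comp (measurable_leftInverse Ψ))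
  -- In the variable `r`, replacing `F_ν⁻¹(φ(u))` by `F_ν⁻¹(u)` exchanges the two left inverses,
  -- hence just the two summands.
  rw [h.lintegral_weight_mul (hm (psiPlus ν μ)) (hm (psiPlus μ ν)),
    h.lintegral_weight_mul (hm (psiPlus μ ν)) (hm (psiPlus ν μ)), add_comm]
  · intro u hu
    rw [leftInverse_psiPlus_psiPlus h.integrable_left h.integrable_right hu.left_mem]
  · intro u hu
    rw [leftInverse_psiPlus_psiPlus h.integrable_right h.integrable_left hu.left_mem]
  · intro u hu
    rw [phi_of_lt hu.left_mem.2.2.2]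
  · intro u hu
    rw [phi_of_gt hu.left_mem.2.2.2]

theorem lintegral_itKernel {u : ℝ} (hw : weight μ ν u ∈ Icc (0 : ℝ) 1) (f : ℝ → ℝ≥0∞) :
    ∫⁻ x, f x ∂(itKernel μ ν u) = ENNReal.ofReal (weight μ ν u) * f (quantile ν (phi μ ν u))
      + ENNReal.ofReal (1 - weight μ ν u) * f (quantile ν u) := by
  have : itKernel μ ν u = ENNReal.ofReal (weight μ ν u) • Measure.dirac (quantile ν (phi μ ν u))
      + ENNReal.ofReal (1 - weight μ ν u) • Measure.dirac (quantile ν u) := by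
    change itMeasure μ ν u = _
    rw [itMeasure, if_pos hw]
  rw [this, lintegral_add_measure, lintegral_smul_measure, lintegral_smul_measure,
    lintegral_dirac, lintegral_dirac, smul_eq_mul, smul_eq_mul]

/-- The second marginal of the inverse transform martingale coupling is `ν`. -/
theorem QuantileDominated.lintegral_lintegral_itKernel (h : QuantileDominated μ ν)
    [IsProbabilityMeasure ν] {f : ℝ → ℝ≥0∞} (hf : Measurable f) :
    ∫⁻ u, ∫⁻ x, f x ∂(itKernel μ ν u) ∂unitLebesgue = ∫⁻ x, f x ∂ν := by
  have hq := measurable_quantile ν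
  have hφ := measurable_phi μ ν
  have hw := measurable_weight μ ν
  calc ∫⁻ u, ∫⁻ x, f x ∂(itKernel μ ν u) ∂unitLebesgue
      = ∫⁻ u, (ENNReal.ofReal (weight μ ν u) * f (quantile ν (phi μ ν u))
        + ENNReal.ofReal (1 - weight μ ν u) * f (quantile ν u)) ∂unitLebesgue :=
        lintegral_congr_ae (h.ae_weight.mono fun u hu => lintegral_itKernel hu.1 f)
    _ = ∫⁻ u, (ENNReal.ofReal (weight μ ν u) * f (quantile ν u)
        + ENNReal.ofReal (1 - weight μ ν u) * f (quantile ν u)) ∂unitLebesgue := by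
        rw [lintegral_add_left (by fun_prop), h.lintegral_weight_mul_comp_phi hf,
          lintegral_add_left (by fun_prop)]
    _ = ∫⁻ u, f (quantile ν u) ∂unitLebesgue := by
        refine lintegral_congr_ae (h.ae_weight.mono fun u hu => ?_)
        simp only
        rw [← add_mul, ← ENNReal.ofReal_add hu.1.1 (sub_nonneg.2 hu.1.2), add_sub_cancel,
          ENNReal.ofReal_one, one_mul]
    _ = ∫⁻ x, f x ∂ν := lintegral_comp_quantile ν hf

end marginal

/-! ### A representation of the kernel on the unit square -/

/-- For fixed `u`, a random variable in `z.2 ∈ (0, 1)` whose law is `itKernel μ ν u`. -/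
def itMap (μ ν : Measure ℝ) (z : ℝ × ℝ) : ℝ :=
  if z.2 < weight μ ν z.1 then quantile ν (phi μ ν z.1) else quantile ν z.1

theorem measurable_itMap (μ ν : Measure ℝ) : Measurable (itMap μ ν) := by
  have hq := measurable_quantile ν
  have hφ := measurable_phi μ ν
  have hw := measurable_weight μ ν
  exact Measurable.ite (measurableSet_lt measurable_snd (by fun_prop)) (by fun_prop) (by fun_prop)

theorem map_itMap {μ ν : Measure ℝ} {u : ℝ} (hw : weight μ ν u ∈ Icc (0 : ℝ) 1) :
    unitLebesgue.map (fun w => itMap μ ν (u, w)) = itKernel μ ν u := by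
  have hm : Measurable fun w => itMap μ ν (u, w) :=
    (measurable_itMap μ ν).comp measurable_prodMk_left
  refine Measure.ext_of_lintegral _ fun f hf => ?_
  rw [lintegral_map hf hm, lintegral_itKernel hw,
    ← lintegral_add_compl _ (measurableSet_Iio (a := weight μ ν u))]
  have h1 : ∫⁻ w in Iio (weight μ ν u), f (itMap μ ν (u, w)) ∂unitLebesgue
      = ∫⁻ w in Iio (weight μ ν u), f (quantile ν (phi μ ν u)) ∂unitLebesgue :=
    setLIntegral_congr_fun measurableSet_Iio fun w hw' => by
      simp only [itMap, if_pos (mem_Iio.1 hw')]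
  have h2 : ∫⁻ w in (Iio (weight μ ν u))ᶜ, f (itMap μ ν (u, w)) ∂unitLebesgue
      = ∫⁻ w in (Iio (weight μ ν u))ᶜ, f (quantile ν u) ∂unitLebesgue :=
    setLIntegral_congr_fun measurableSet_Iio.compl fun w hw' => by
      simp only [itMap, if_neg (fun h => hw' (mem_Iio.2 h))]
  rw [h1, h2, setLIntegral_const, setLIntegral_const, prob_compl_eq_one_sub measurableSet_Iio,
    unitLebesgue_Iio hw, ← ENNReal.ofReal_one, ← ENNReal.ofReal_sub _ hw.1, mul_comm,
    mul_comm (f (quantile ν u))]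

theorem QuantileDominated.lintegral_comp_itMap {μ ν : Measure ℝ} (h : QuantileDominated μ ν)
    [IsProbabilityMeasure ν] {f : ℝ → ℝ≥0∞} (hf : Measurable f) :
    ∫⁻ z, f (itMap μ ν z) ∂(unitLebesgue.prod unitLebesgue) = ∫⁻ x, f x ∂ν := by
  have hY := measurable_itMap μ ν
  rw [lintegral_prod _ (by fun_prop),
    ← h.lintegral_lintegral_itKernel hf]
  refine lintegral_congr_ae (h.ae_weight.mono fun u hu => ?_)
  have hm : Measurable fun w => itMap μ ν (u, w) :=
    (measurable_itMap μ ν).comp measurable_prodMk_left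
  simp only
  rw [← map_itMap hu.1, lintegral_map hf hm]

/-- For fixed `u`, using the same `w` in both maps couples the two kernels. -/
theorem lintegral_wasserstein_itKernel_le {ρ : ℝ} (hρ : 0 < ρ) {μ ν μ' ν' : Measure ℝ}
    (h : QuantileDominated μ ν) (h' : QuantileDominated μ' ν') :
    ∫⁻ u, wasserstein ρ (itKernel μ ν u) (itKernel μ' ν' u) ^ ρ ∂unitLebesgue
      ≤ ∫⁻ z, edist (itMap μ ν z) (itMap μ' ν' z) ^ ρ ∂(unitLebesgue.prod unitLebesgue) := by
  have m1 := measurable_itMap μ ν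
  have m2 := measurable_itMap μ' ν'
  rw [lintegral_prod _ (by fun_prop)]
  refine lintegral_mono_ae ?_
  filter_upwards [h.ae_weight, h'.ae_weight] with u hu hu'
  rw [← map_itMap hu.1, ← map_itMap hu'.1]
  exact wasserstein_map_rpow_le hρ _ (m1.comp measurable_prodMk_left)
    (m2.comp measurable_prodMk_left)

theorem QuantileDominated.ae_integral_itKernel {μ ν : Measure ℝ} (h : QuantileDominated μ ν) :
    ∀ᵐ u ∂unitLebesgue, Integrable id (itKernel μ ν u) ∧
      ∫ x, x ∂(itKernel μ ν u) = quantile μ u := by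
  filter_upwards [h.ae_weight] with u ⟨hw, heq⟩
  have hk : itKernel μ ν u
      = ENNReal.ofReal (weight μ ν u) • Measure.dirac (quantile ν (phi μ ν u))
        + ENNReal.ofReal (1 - weight μ ν u) • Measure.dirac (quantile ν u) := by
    change itMeasure μ ν u = _
    rw [itMeasure, if_pos hw]
  have hi : ∀ (c x : ℝ), Integrable (fun y : ℝ => y) (ENNReal.ofReal c • Measure.dirac x) :=
    fun c x => (integrable_dirac (by simp)).smul_measure ENNReal.ofReal_ne_top
  rw [hk]
  refine ⟨(hi _ _).add_measure (hi _ _), ?_⟩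
  rw [integral_add_measure (hi _ _) (hi _ _), integral_smul_measure, integral_smul_measure,
    integral_dirac, integral_dirac, ENNReal.toReal_ofReal hw.1,
    ENNReal.toReal_ofReal (sub_nonneg.2 hw.2), smul_eq_mul, smul_eq_mul]
  linear_combination heq

/-! ### Convergence of the kernels -/

theorem tendsto_ite_lt {p : ℕ → ℝ} {q w : ℝ} (hp : Tendsto p atTop (𝓝 q)) (hw : w ≠ q)
    {x y : ℕ → ℝ} {x' y' : ℝ} (hx : Tendsto x atTop (𝓝 x')) (hy : Tendsto y atTop (𝓝 y')) :
    Tendsto (fun n => if w < p n then x n else y n) atTop (𝓝 (if w < q then x' else y')) := by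
  rcases hw.lt_or_gt with h | h
  · rw [if_pos h]
    exact hx.congr' ((hp.eventually_const_lt h).mono fun n hn => (if_pos hn).symm)
  · rw [if_neg h.not_gt]
    exact hy.congr' ((hp.eventually_lt_const h).mono fun n hn => (if_neg hn.not_gt).symm)

/-- When the first branch is taken, `w < p n` bounds the jump `|x n - y n|` by `|p n * (x n - y n)|
/ w`. No separate control of `p n` or `x n` is required. -/
theorem tendsto_ite_lt_of_mul_tendsto_zero {p : ℕ → ℝ} {w : ℝ} (hw : 0 < w)
    {x y : ℕ → ℝ} {l : ℝ} (hp : Tendsto (fun n => p n * (x n - y n)) atTop (𝓝 0))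
    (hy : Tendsto y atTop (𝓝 l)) :
    Tendsto (fun n => if w < p n then x n else y n) atTop (𝓝 l) := by
  have h : Tendsto (fun n => (if w < p n then x n else y n) - y n) atTop (𝓝 0) := by
    have h0 : Tendsto (fun n => |p n * (x n - y n)| / w) atTop (𝓝 0) := by
      simpa using hp.abs.div_const w
    refine squeeze_zero_norm (fun n => ?_) h0
    rw [Real.norm_eq_abs, le_div_iff₀ hw, abs_mul]
    split_ifs with hlt
    · rw [mul_comm]
      exact mul_le_mul_of_nonneg_right (hlt.le.trans (le_abs_self _)) (abs_nonneg _)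
    · simp only [sub_self, abs_zero, zero_mul]
      positivity
  simpa using h.add hy

theorem IsMatched.tendsto_leftInverse {an bn : ℕ → Measure ℝ} {a b : Measure ℝ}
    (hab : ∀ n, IsCumulative (psiPlus (an n) (bn n)))
    (hba : ∀ n, IsCumulative (psiPlus (bn n) (an n)))
    (h1 : ∀ n, psiPlus (an n) (bn n) 1 = psiPlus (bn n) (an n) 1)
    (hlab : ∀ v ∈ Icc (0 : ℝ) 1, Tendsto (fun n => psiPlus (an n) (bn n) v) atTop
      (𝓝 (psiPlus a b v)))
    (hlba : ∀ v ∈ Icc (0 : ℝ) 1, Tendsto (fun n => psiPlus (bn n) (an n) v) atTop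
      (𝓝 (psiPlus b a v))) {u c : ℝ} (hm : IsMatched a b u c) :
    Tendsto (fun n => leftInverse (psiPlus (bn n) (an n)) (psiPlus (an n) (bn n) u)) atTop
      (𝓝 c) := by
  have hI := Ioo_subset_Icc_self hm.left_mem.1
  exact LiftedIT.tendsto_leftInverse hba hlba (hlab u hI)
    (fun n => h1 n ▸ (hab n).mem_Icc hI) hm.right_mem hm.lt hm.gt

section convergence

variable {ρ : ℝ} {μn νn : ℕ → Measure ℝ} {μ ν : Measure ℝ}

theorem tendsto_itMap_of_tendsto_phi {u w : ℝ} (hne : quantile μ u ≠ quantile ν u)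
    (hden : quantile ν (phi μ ν u) ≠ quantile ν u) (hw : w ≠ weight μ ν u)
    (hqμ : Tendsto (fun n => quantile (μn n) u) atTop (𝓝 (quantile μ u)))
    (hqν : Tendsto (fun n => quantile (νn n) u) atTop (𝓝 (quantile ν u)))
    (hφ : Tendsto (fun n => quantile (νn n) (phi (μn n) (νn n) u)) atTop
      (𝓝 (quantile ν (phi μ ν u)))) :
    Tendsto (fun n => itMap (μn n) (νn n) (u, w)) atTop (𝓝 (itMap μ ν (u, w))) := by
  refine tendsto_ite_lt ?_ hw hφ hqν
  simp only
  rw [weight_of_ne hne]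
  refine Tendsto.congr' ?_ ((hqμ.sub hqν).div (hφ.sub hqν) (sub_ne_zero.2 hden))
  filter_upwards [(hqμ.sub hqν).eventually_ne (sub_ne_zero.2 hne)] with n hn
  exact (weight_of_ne (sub_ne_zero.1 hn)).symm

theorem ae_tendsto_itMap (hρ : 1 ≤ ρ) [∀ n, IsProbabilityMeasure (νn n)] [IsProbabilityMeasure ν]
    (hn : ∀ n, QuantileDominated (μn n) (νn n)) (h : QuantileDominated μ ν)
    (hqμ : ∀ᵐ u ∂unitLebesgue, Tendsto (fun n => quantile (μn n) u) atTop (𝓝 (quantile μ u)))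
    (hν : Tendsto (fun n => wasserstein ρ (νn n) ν) atTop (𝓝 0))
    (hp : ∀ v ∈ Icc (0 : ℝ) 1, Tendsto (fun n => psiPlus (μn n) (νn n) v) atTop
      (𝓝 (psiPlus μ ν v)))
    (hm : ∀ v ∈ Icc (0 : ℝ) 1, Tendsto (fun n => psiPlus (νn n) (μn n) v) atTop
      (𝓝 (psiPlus ν μ v))) :
    ∀ᵐ z ∂(unitLebesgue.prod unitLebesgue),
      Tendsto (fun n => itMap (μn n) (νn n) z) atTop (𝓝 (itMap μ ν z)) := by
  have hset : MeasurableSet {z : ℝ × ℝ |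
      Tendsto (fun n => itMap (μn n) (νn n) z) atTop (𝓝 (itMap μ ν z))} :=
    measurableSet_tendsto_fun (fun n => measurable_itMap (μn n) (νn n)) (measurable_itMap μ ν)
  rw [Measure.ae_prod_iff_ae_ae hset]
  have c1 : ∀ n, IsCumulative (psiPlus (μn n) (νn n)) := fun n =>
    isCumulative_psiPlus (hn n).integrable_left (hn n).integrable_right
  have c2 : ∀ n, IsCumulative (psiPlus (νn n) (μn n)) := fun n =>
    isCumulative_psiPlus (hn n).integrable_right (hn n).integrable_left
  filter_upwards [h.ae_trichotomy, hqμ, ae_tendsto_quantile hρ hν,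
    ae_all_iff.2 fun n => (hn n).ae_weight] with u hu qμ qν hwn
  have hae : ∀ᵐ w ∂unitLebesgue, w ≠ weight μ ν u :=
    ae_restrict_of_ae (s := Ioo (0 : ℝ) 1) ((countable_singleton (weight μ ν u)).ae_notMem volume)
  filter_upwards [hae, ae_mem_Ioo_unitLebesgue] with w hw hw0
  rcases hu with hu | hu | heq
  · have hlt := hu.left_mem.2.2.2
    refine tendsto_itMap_of_tendsto_phi hlt.ne' (hlt.trans (hu.quantile_lt_of_left h)).ne' hw qμ qν
      (tendsto_quantile_of_tendsto_wasserstein hρ hν ?_ hu.right_mem hu.continuousAt_right)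
    refine (hu.tendsto_leftInverse c1 c2 (fun n => (hn n).eq.symm) hp hm).congr' ?_
    -- The strict inequality of quantiles persists for large `n`, so `phi` eventually takes the same
    -- branch.
    filter_upwards [qν.eventually_lt qμ hlt] with n hlt'
    exact (phi_of_lt hlt').symm
  · have hlt := hu.left_mem.2.2.2
    refine tendsto_itMap_of_tendsto_phi hlt.ne ((hu.quantile_lt_of_right h).trans hlt).ne hw qμ qν
      (tendsto_quantile_of_tendsto_wasserstein hρ hν ?_ hu.right_mem hu.continuousAt_left)
    refine (hu.tendsto_leftInverse c2 c1 (fun n => (hn n).eq) hm hp).congr' ?_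
    filter_upwards [qμ.eventually_lt qν hlt] with n hlt'
    exact (phi_of_gt hlt').symm
  · have hlim : itMap μ ν (u, w) = quantile ν u := by
      simp only [itMap, weight_of_eq heq, if_neg hw0.1.not_gt]
    rw [hlim]
    refine tendsto_ite_lt_of_mul_tendsto_zero hw0.1 ?_ qν
    have := qμ.sub qν
    rw [heq, sub_self] at this
    -- The martingale identity turns weight times jump into the difference of quantiles, which
    -- vanishes in the limit.
    exact this.congr fun n => ((hwn n).2).symm

theorem tendsto_lintegral_wasserstein_itKernel (hρ : 1 ≤ ρ)
    [∀ n, IsProbabilityMeasure (νn n)] (hν : HasFiniteMoment ρ ν)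
    (hn : ∀ n, QuantileDominated (μn n) (νn n)) (h : QuantileDominated μ ν)
    (hνlim : Tendsto (fun n => wasserstein ρ (νn n) ν) atTop (𝓝 0))
    (hlim : ∀ᵐ z ∂(unitLebesgue.prod unitLebesgue),
      Tendsto (fun n => itMap (μn n) (νn n) z) atTop (𝓝 (itMap μ ν z))) :
    Tendsto (fun n => ∫⁻ u, wasserstein ρ (itKernel (μn n) (νn n) u) (itKernel μ ν u) ^ ρ
      ∂unitLebesgue) atTop (𝓝 0) := by
  have := hν.isProbabilityMeasure
  have hρ0 : 0 < ρ := one_pos.trans_le hρ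
  have hf : Measurable fun x : ℝ => ‖x‖ₑ ^ ρ := by fun_prop
  have hI := h.lintegral_comp_itMap hf
  refine tendsto_of_tendsto_of_tendsto_of_le_of_le tendsto_const_nhds
    (tendsto_lintegral_edist_rpow_of_ae_tendsto hρ
      (fun n => measurable_itMap (μn n) (νn n)) (measurable_itMap μ ν) hlim
      (A := fun n => ((∫⁻ x, ‖x‖ₑ ^ ρ ∂ν) ^ (1 / ρ) + wasserstein ρ (νn n) ν) ^ ρ)
      (fun n => ((hn n).lintegral_comp_itMap hf).trans_le
        (lintegral_enorm_rpow_le_add_wasserstein hρ _ _))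
      (hI.symm ▸ tendsto_rpow_add_wasserstein hρ _ hνlim)
      (hI.symm ▸ hν.lintegral_ne_top hρ0)) (fun _ => zero_le)
    fun n => lintegral_wasserstein_itKernel_le hρ0 (hn n) h

end convergence

/-! ### The adapted Wasserstein distances -/

theorem adaptedWasserstein_rpow_le {ρ : ℝ} (hρ : 0 < ρ) {π π' : Measure (ℝ × ℝ)}
    [IsFiniteMeasure π] [IsFiniteMeasure π'] {χ : Measure (ℝ × ℝ)}
    (hχ : χ ∈ couplings π.fst π'.fst) :
    adaptedWasserstein ρ π π' ^ ρ ≤ ∫⁻ z, (edist z.1 z.2 ^ ρ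
      + wasserstein ρ (π.condKernel z.1) (π'.condKernel z.2) ^ ρ) ∂χ :=
  (ENNReal.le_rpow_inv_iff hρ).1 (one_div ρ ▸ iInf₂_le χ hχ)

theorem liftedAdaptedWasserstein_rpow_le {ρ : ℝ} (hρ : 0 < ρ) {π π' : Measure (ℝ × (ℝ × ℝ))}
    [IsFiniteMeasure π] [IsFiniteMeasure π'] {χ : Measure (ℝ × ℝ)}
    (hχ : χ ∈ couplings unitLebesgue unitLebesgue) :
    liftedAdaptedWasserstein ρ π π' ^ ρ ≤ ∫⁻ z, (edist z.1 z.2 ^ ρ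
      + adaptedWasserstein ρ (π.condKernel z.1) (π'.condKernel z.2) ^ ρ) ∂χ :=
  (ENNReal.le_rpow_inv_iff hρ).1 (one_div ρ ▸ iInf₂_le χ hχ)

/-- The conditional kernel is determined only almost everywhere, but for a Dirac first marginal that
includes the atom itself. -/
theorem condKernel_dirac_prod (x : ℝ) (m : Measure ℝ) [IsProbabilityMeasure m] :
    ((Measure.dirac x).prod m).condKernel x = m := by
  have h : ((Measure.dirac x).prod m).condKernel =ᵐ[Measure.dirac x] Kernel.const ℝ m := by
    simp only [← Measure.compProd_const]
    exact condKernel_compProd _ _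
  rwa [ae_dirac_eq] at h

theorem adaptedWasserstein_dirac_prod_rpow_le {ρ : ℝ} (hρ : 0 < ρ) {x x' : ℝ} {m m' : Measure ℝ}
    [IsProbabilityMeasure m] [IsProbabilityMeasure m'] {π π' : Measure (ℝ × ℝ)}
    [IsFiniteMeasure π] [IsFiniteMeasure π'] (hπ : π = (Measure.dirac x).prod m)
    (hπ' : π' = (Measure.dirac x').prod m') :
    adaptedWasserstein ρ π π' ^ ρ ≤ edist x x' ^ ρ + wasserstein ρ m m' ^ ρ := by
  subst hπ hπ'
  have hχ : Measure.dirac (x, x') ∈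
      couplings ((Measure.dirac x).prod m).fst ((Measure.dirac x').prod m').fst := by
    rw [Measure.fst_prod, Measure.fst_prod]
    exact ⟨Measure.map_dirac' measurable_fst _, Measure.map_dirac' measurable_snd _⟩
  refine (adaptedWasserstein_rpow_le hρ hχ).trans (le_of_eq ?_)
  rw [lintegral_dirac, condKernel_dirac_prod, condKernel_dirac_prod]

theorem ae_condKernel_liftedCoupling (μ : Measure ℝ) (p : Kernel ℝ ℝ) [IsMarkovKernel p] :
    ∀ᵐ u ∂unitLebesgue,
      (liftedCoupling μ p).condKernel u = (Measure.dirac (quantile μ u)).prod (p u) := by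
  filter_upwards [condKernel_compProd unitLebesgue
    ((Kernel.deterministic (quantile μ) (measurable_quantile μ)).prod p)] with u hu
  simp only [liftedCoupling]
  rw [hu, Kernel.prod_apply, Kernel.deterministic_apply]

/-- The diagonal coupling removes the cost in `u`. By the martingale property the first coordinates
are the means of the kernels, so their distance is absorbed by a second copy of the kernel distance.
-/
theorem liftedAdaptedWasserstein_liftedIT_rpow_le {ρ : ℝ} (hρ : 1 ≤ ρ) {μ ν μ' ν' : Measure ℝ}
    (h : QuantileDominated μ ν) (h' : QuantileDominated μ' ν') :
    liftedAdaptedWasserstein ρ (liftedIT μ ν) (liftedIT μ' ν') ^ ρ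
      ≤ 2 * ∫⁻ u, wasserstein ρ (itKernel μ ν u) (itKernel μ' ν' u) ^ ρ ∂unitLebesgue := by
  have hρ0 : 0 < ρ := one_pos.trans_le hρ
  have hχ : unitLebesgue.map (fun u => (u, u)) ∈ couplings unitLebesgue unitLebesgue := by
    simpa using map_mem_couplings unitLebesgue measurable_id measurable_id
  refine ((liftedAdaptedWasserstein_rpow_le hρ0 hχ).trans (lintegral_map_le _ _)).trans ?_
  rw [← lintegral_const_mul' _ _ (by simp)]
  refine lintegral_mono_ae ?_
  filter_upwards [ae_condKernel_liftedCoupling μ (itKernel μ ν),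
    ae_condKernel_liftedCoupling μ' (itKernel μ' ν'), h.ae_integral_itKernel,
    h'.ae_integral_itKernel] with u hu hu' ⟨hi, he⟩ ⟨hi', he'⟩
  have hdist : edist (quantile μ u) (quantile μ' u)
      ≤ wasserstein ρ (itKernel μ ν u) (itKernel μ' ν' u) := by
    rw [edist_eq_enorm_sub, ← he, ← he']
    exact enorm_integral_sub_integral_le_wasserstein hρ hi hi'
  simp only [edist_self, ENNReal.zero_rpow_of_pos hρ0, zero_add]
  refine (adaptedWasserstein_dirac_prod_rpow_le hρ0 hu hu').trans ?_
  rw [two_mul]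
  gcongr

end LiftedIT

end

/-! ### Convergence of the lifted couplings -/

theorem mainTheorem5 (ρ : ℝ) (hρ : 1 ≤ ρ)
    (μn νn : ℕ → Measure ℝ) (μ ν : Measure ℝ)
    (hμn : ∀ n, LiftedIT.HasFiniteMoment ρ (μn n)) (hνn : ∀ n, LiftedIT.HasFiniteMoment ρ (νn n))
    (hμ : LiftedIT.HasFiniteMoment ρ μ) (hν : LiftedIT.HasFiniteMoment ρ ν)
    (hcx : ∀ n, LiftedIT.ConvexOrder (μn n) (νn n))
    (hμlim : Tendsto (fun n => LiftedIT.wasserstein ρ (μn n) μ) atTop (𝓝 0))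
    (hνlim : Tendsto (fun n => LiftedIT.wasserstein ρ (νn n) ν) atTop (𝓝 0)) :
    (∀ n, LiftedIT.liftedAdaptedWasserstein ρ (LiftedIT.liftedIT (μn n) (νn n))
          (LiftedIT.liftedIT μ ν) ^ ρ
        ≤ 2 * ∫⁻ u in Ioo (0 : ℝ) 1, LiftedIT.wasserstein ρ
            (LiftedIT.itKernel (μn n) (νn n) u) (LiftedIT.itKernel μ ν u) ^ ρ) ∧
    Tendsto (fun n => ∫⁻ u in Ioo (0 : ℝ) 1, LiftedIT.wasserstein ρ
        (LiftedIT.itKernel (μn n) (νn n) u) (LiftedIT.itKernel μ ν u) ^ ρ) atTop (𝓝 0) ∧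
    Tendsto (fun n => LiftedIT.liftedAdaptedWasserstein ρ (LiftedIT.liftedIT (μn n) (νn n))
        (LiftedIT.liftedIT μ ν)) atTop (𝓝 0) := by
  have hρ0 : 0 < ρ := one_pos.trans_le hρ
  have := fun n => (hμn n).isProbabilityMeasure
  have := fun n => (hνn n).isProbabilityMeasure
  have := hμ.isProbabilityMeasure
  have := hν.isProbabilityMeasure
  have hn : ∀ n, LiftedIT.QuantileDominated (μn n) (νn n) := fun n =>
    (hcx n).quantileDominated ((hμn n).integrable_id hρ) ((hνn n).integrable_id hρ)
  have iμ := LiftedIT.integrable_quantile μ (hμ.integrable_id hρ)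
  have iν := LiftedIT.integrable_quantile ν (hν.integrable_id hρ)
  have lμ := LiftedIT.tendsto_lintegral_edist_quantile hρ hμ hμlim
  have lν := LiftedIT.tendsto_lintegral_edist_quantile hρ hν hνlim
  have hp : ∀ v ∈ Icc (0 : ℝ) 1, Tendsto (fun n => LiftedIT.psiPlus (μn n) (νn n) v) atTop
      (𝓝 (LiftedIT.psiPlus μ ν v)) := fun v hv =>
    LiftedIT.tendsto_psiPlus (fun n => (hn n).integrable_left) (fun n => (hn n).integrable_right)
      iμ iν lμ lν hv
  have hm : ∀ v ∈ Icc (0 : ℝ) 1, Tendsto (fun n => LiftedIT.psiPlus (νn n) (μn n) v) atTop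
      (𝓝 (LiftedIT.psiPlus ν μ v)) := fun v hv =>
    LiftedIT.tendsto_psiPlus (fun n => (hn n).integrable_right) (fun n => (hn n).integrable_left)
      iν iμ lν lμ hv
  have h : LiftedIT.QuantileDominated μ ν := .of_tendsto hn iμ iν hp hm
  have h1 := fun n => LiftedIT.liftedAdaptedWasserstein_liftedIT_rpow_le hρ (hn n) h
  have h2 := LiftedIT.tendsto_lintegral_wasserstein_itKernel hρ hν hn h hνlim
    (LiftedIT.ae_tendsto_itMap hρ hn h (LiftedIT.ae_tendsto_quantile hρ hμlim) hνlim hp hm)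
  refine ⟨h1, h2, ?_⟩
  have h3 := ENNReal.Tendsto.const_mul (a := 2) h2 (Or.inr (by simp))
  rw [mul_zero] at h3
  have h4 := tendsto_of_tendsto_of_tendsto_of_le_of_le tendsto_const_nhds h3
    (fun _ => zero_le) h1
  have h5 := ((ENNReal.continuous_rpow_const (y := ρ⁻¹)).tendsto 0).comp h4
  rw [ENNReal.zero_rpow_of_pos (inv_pos.2 hρ0)] at h5
  exact h5.congr fun n => ENNReal.rpow_rpow_inv hρ0.ne' _
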